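/- Fix a pathloss exponent $\alpha>2$, a base-station (BS) height $h>0$ and a threshold $\theta>0$. Let ${}_2F_1$ denote the Gauss hypergeometric function (continued analytically to $(-\infty,1)$), and put $$\eta(s,m,r)={}_2F_1\big(m,-\tfrac2\alpha;1-\tfrac2\alpha;-\tfrac{s}{m r^{\alpha}}\big),\qquad \zeta(m)=-\frac{\Gamma(m+\frac2\alpha)\,\Gamma(-\frac2\alpha)}{\alpha\,\Gamma(m)} .$$ The non-elevated ($h=0$) Rayleigh coverage probabilities for closest (C) and strongest (S) association are $$\mathrm P^{\mathrm{NLOS},(\mathrm C)}(\theta)=\frac1{\eta(\theta,1,1)},\qquad \mathrm P^{\mathrm{NLOS},(\mathrm S)}(\theta)=\frac1{2\zeta(1)\theta^{2/\alpha}} .$$ For BS density $\lambda>0$ the coverage expressions with BSs at height $h$ are $$\mathrm P^{(\mathrm C)}(\theta,\lambda)=\mathrm P^{\mathrm{NLOS},(\mathrm C)}(\theta)\,e^{-\pi\lambda h^2(\eta(\theta,1,1)-1)},\qquad \mathrm P^{(\mathrm S)}(\theta,\lambda)=2\pi\lambda\int_h^\infty e^{-\pi\lambda h^2(\eta(\theta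 r^\alpha,1,h)-1)}\,r\,dr .$$ (1) The integral defining $\mathrm P^{(\mathrm S)}(\theta,\lambda)$ converges for every $\lambda>0$, and (a) $\lim_{\lambda\to0^+}\mathrm P^{(\mathrm C)}(\theta,\lambda)=\mathrm P^{\mathrm{NLOS},(\mathrm C)}(\theta)$; (b) $\lim_{\lambda\to0^+}\mathrm P^{(\mathrm S)}(\theta,\lambda)=\mathrm P^{\mathrm{NLOS},(\mathrm S)}(\theta)$; (c) $\lim_{\lambda\to\infty}\mathrm P^{(\mathrm C)}(\theta,\lambda)=\lim_{\lambda\to\infty}\mathrm P^{(\mathrm S)}(\theta,\lambda)=0$. (2) The same limits hold for the probabilities of coverage themselves. For each $\lambda>0$ let the BSs form a homogeneous Poisson point process $\{x_i\}$ of density $\lambda$ on $\mathbb R^2$, independently marked by i.i.d. $\exp(1)$ fading gains $g_i$, let $\ell(r,h)=(r^2+h^2)^{-\alpha/2}$ and $$\mathrm{SIR}_i=\frac{g_i\,\ell(\|x_i\|,h)}{\sum_{j\ne i}g_j\,\ell(\|x_j\|,h)} .$$ Let $p_{\mathrm C}(\theta,\lambda)$ be the probability that $\mathrm{SIR}_i>\theta$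 for the BS $x_i$ closest to the origin, and $p_{\mathrm S}(\theta,\lambda)$ the probability that $\mathrm{SIR}_i>\theta$ for the BS with the highest SIR. Then $p_{\mathrm C}(\theta,\lambda)\to\mathrm P^{\mathrm{NLOS},(\mathrm C)}(\theta)$ as $\lambda\to0^+$; if $\theta\ge1$, also $p_{\mathrm S}(\theta,\lambda)\to\mathrm P^{\mathrm{NLOS},(\mathrm S)}(\theta)$ as $\lambda\to0^+$; and $p_{\mathrm C}(\theta,\lambda)\to0$ and $p_{\mathrm S}(\theta,\lambda)\to0$ as $\lambda\to\infty$. -/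

import Mathlib

open MeasureTheory ProbabilityTheory Set Filter Topology
open scoped NNReal ENNReal

/-! ### Special functions -/

open Classical in
/-- The Gauss hypergeometric function with real parameters on the half-line `x < 1`: the
real-analytic continuation to `(-∞, 1)` of the Gauss series `₂F₁ a b c`, which converges on
`(-1, 1)`. (Value `0` if there were no such continuation.) -/
noncomputable def gauss2F1 (a b c x : ℝ) : ℝ :=
  if H : ∃ F : ℝ → ℝ, AnalyticOnNhd ℝ F (Iio 1) ∧ ∀ y : ℝ, |y| < 1 → F y = ₂F₁ a b c y then
    H.choose x
  else 0

/-- Any real-analytic continuation of the Gauss series to `(-∞, 1)` computes `gauss2F1`. -/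
theorem gauss2F1_eq {a b c : ℝ} {F : ℝ → ℝ} (hF : AnalyticOnNhd ℝ F (Iio 1))
    (hs : ∀ y : ℝ, |y| < 1 → F y = ₂F₁ a b c y) {x : ℝ} (hx : x < 1) :
    gauss2F1 a b c x = F x := by
  have H : ∃ F : ℝ → ℝ, AnalyticOnNhd ℝ F (Iio 1) ∧
      ∀ y : ℝ, |y| < 1 → F y = ₂F₁ a b c y := ⟨F, hF, hs⟩
  rw [gauss2F1, dif_pos H]
  refine H.choose_spec.1.eqOn_of_preconnected_of_eventuallyEq hF isPreconnected_Iio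
    (z₀ := 0) (by simp) ?_ hx
  filter_upwards [Metric.ball_mem_nhds (0 : ℝ) one_pos] with y hy
  have hy' : |y| < 1 := by simpa using hy
  rw [H.choose_spec.2 y hy', hs y hy']

/-- `η(s, m, r) = ₂F₁(m, -2/α; 1 - 2/α; -s / (m r ^ α))`. -/
noncomputable def eta (α s m r : ℝ) : ℝ :=
  gauss2F1 m (-(2 / α)) (1 - 2 / α) (-(s / (m * r ^ α)))

/-- `ζ(m) = - Γ(m + 2/α) Γ(-2/α) / (α Γ(m))`. -/
noncomputable def zetaFading (α m : ℝ) : ℝ :=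
  -(Real.Gamma (m + 2 / α) * Real.Gamma (-(2 / α))) / (α * Real.Gamma m)

/-! ### Coverage expressions -/

/-- Coverage probability with non-elevated base stations, Rayleigh fading, closest association:
`1 / η(θ, 1, 1)`. -/
noncomputable def covNlosClosest (α θ : ℝ) : ℝ := 1 / eta α θ 1 1

/-- Coverage probability with non-elevated base stations, Rayleigh fading, strongest association:
`1 / (2 ζ(1) θ ^ (2/α))`. -/
noncomputable def covNlosStrongest (α θ : ℝ) : ℝ := 1 / (2 * zetaFading α 1 * θ ^ (2 / α))

/-- Coverage expression with base stations at height `h` and density `lam`, closest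
association. -/
noncomputable def covFormulaClosest (α h θ lam : ℝ) : ℝ :=
  covNlosClosest α θ * Real.exp (-(Real.pi * lam * h ^ 2 * (eta α θ 1 1 - 1)))

/-- The integrand of the coverage expression for strongest association. -/
noncomputable def covIntegrandStrongest (α h θ lam r : ℝ) : ℝ :=
  Real.exp (-(Real.pi * lam * h ^ 2 * (eta α (θ * r ^ α) 1 h - 1))) * r

/-- Coverage expression with base stations at height `h` and density `lam`, strongest
association. -/
noncomputable def covFormulaStrongest (α h θ lam : ℝ) : ℝ :=
  2 * Real.pi * lam * ∫ r in Ioi h, covIntegrandStrongest α h θ lam r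

/-! ### The network -/

/-- The Euclidean plane. -/
abbrev Plane : Type := EuclideanSpace ℝ (Fin 2)

/-- The number of points of the configuration `(X i ω)` that lie in `B`. -/
noncomputable def pointCount {Ω : Type*} (X : ℕ → Ω → Plane) (B : Set Plane) (ω : Ω) : ℕ∞ :=
  {i | X i ω ∈ B}.encard

/-- The points `X i` (listed in some order) form a homogeneous Poisson point process of density
`lam` on the plane: the numbers of points in bounded Borel sets are Poisson distributed with
parameter `lam` times the area, and are independent for disjoint sets. -/
structure IsPoissonProcess {Ω : Type*} [MeasurableSpace Ω] (P : Measure Ω) (lam : ℝ)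
    (X : ℕ → Ω → Plane) : Prop where
  measurable : ∀ i, Measurable (X i)
  count_law : ∀ B : Set Plane, MeasurableSet B → Bornology.IsBounded B → ∀ n : ℕ,
    P {ω | pointCount X B ω = n} = poissonMeasure (Real.toNNReal (lam * volume.real B)) {n}
  count_indep : ∀ (k : ℕ) (B : Fin k → Set Plane), (∀ j, MeasurableSet (B j)) →
    (∀ j, Bornology.IsBounded (B j)) → Pairwise (fun i j => Disjoint (B i) (B j)) →
    iIndepFun (fun j => pointCount X (B j)) P

/-- A cellular network with Rayleigh fading: the base stations `X i` form a homogeneous Poisson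
point process of density `lam`, independently marked by i.i.d. `exp(1)` power fading gains
`g i`. -/
structure IsRayleighNetwork {Ω : Type*} [MeasurableSpace Ω] (P : Measure Ω) (lam : ℝ)
    (X : ℕ → Ω → Plane) (g : ℕ → Ω → ℝ) : Prop where
  isProbabilityMeasure : IsProbabilityMeasure P
  poisson : IsPoissonProcess P lam X
  fading_measurable : ∀ i, Measurable (g i)
  fading_law : ∀ i, P.map (g i) = expMeasure 1
  fading_indep : iIndepFun g P
  marks_indep : IndepFun (fun ω i => X i ω) (fun ω i => g i ω) P

/-- The power-law pathloss `(r ^ 2 + h ^ 2) ^ (-α/2)` at horizontal distance `r` and elevation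
`h`. -/
noncomputable def pathLoss (α h r : ℝ) : ℝ := (r ^ 2 + h ^ 2) ^ (-(α / 2))

section SIR

variable {Ω : Type*} (α h : ℝ) (X : ℕ → Ω → Plane) (g : ℕ → Ω → ℝ)

/-- Power received at the origin from the `i`-th base station. -/
noncomputable def rxPower (i : ℕ) (ω : Ω) : ℝ≥0∞ :=
  ENNReal.ofReal (g i ω * pathLoss α h ‖X i ω‖)

/-- Aggregate interference when the `i`-th base station is serving. -/
noncomputable def interference (i : ℕ) (ω : Ω) : ℝ≥0∞ :=
  ∑' j : {j : ℕ // j ≠ i}, rxPower α h X g j ω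

/-- Signal-to-interference ratio when the `i`-th base station is serving. -/
noncomputable def sir (i : ℕ) (ω : Ω) : ℝ≥0∞ :=
  rxPower α h X g i ω / interference α h X g i ω

/-- Coverage probability at threshold `θ` when the origin is served by the closest base
station. -/
noncomputable def covProbClosest [MeasurableSpace Ω] (P : Measure Ω) (θ : ℝ) : ℝ :=
  P.real {ω | ∃ i, (∀ j, ‖X i ω‖ ≤ ‖X j ω‖) ∧ ENNReal.ofReal θ < sir α h X g i ω}

/-- Coverage probability at threshold `θ` when the origin is served by the base station with the
highest signal-to-interference ratio. -/
noncomputable def covProbStrongest [MeasurableSpace Ω] (P : Measure Ω) (θ : ℝ) : ℝ :=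
  P.real {ω | ∃ i, (∀ j, sir α h X g j ω ≤ sir α h X g i ω) ∧
    ENNReal.ofReal θ < sir α h X g i ω}

end SIR

/-!
Let `E_i` be the event that the `i`-th station serves the origin and has SIR above `θ`. The
coverage probability is at most `∑ i, P E_i`, with equality when the `E_i` are disjoint: for
closest association always, up to ties that do not change the sum, and for strongest association
when `θ ≥ 1`, since then at most one SIR exceeds `θ`. Given the locations, the `exp(1)` gains turn
the event `SIR_i > θ` into a product over `j ≠ i` of a kernel `F` which, after mapping each station
at distance `r` to the area `s = π r ^ 2`, is monotone in both arguments. The Mecke formula then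
gives `lam * ∫ s, exp (-lam * ∫ t, (1 - F s t))` for `∑ i, P E_i`. For monotone kernels it follows
from the Poisson counts of finitely many cells: cut the plane into annuli of equal area, bound the
kernel from both sides by its values on the annuli, and let the area tend to `0`.

For closest association the inner integral is affine in `s`, which gives the closed formula. For
strongest association it lies within a constant of a linear function of `s` with slope
`∫ v, θ / (v ^ a + θ)`, `a = α / 2`, so the limit as `lam → 0` is the inverse of this slope; and it
exceeds an affine function with positive constant term, so the limit as `lam → ∞` is `0`.
-/

/-! ### The hypergeometric function as an integral -/

section CauchyTransform

theorem pow_mul_inv_pow_succ (u w : ℝ) (n : ℕ) : u ^ n * (w ^ (n + 1))⁻¹ = (u / w) ^ n * w⁻¹ := by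
  rw [div_pow, pow_succ, mul_inv, div_eq_mul_inv, mul_assoc]

theorem hasSum_pow_mul_inv_pow_sub {x₀ x y : ℝ} (h : |x - x₀| < |y - x₀|) :
    HasSum (fun n : ℕ => (x - x₀) ^ n * ((y - x₀) ^ (n + 1))⁻¹) (y - x)⁻¹ := by
  have hy : y - x₀ ≠ 0 := abs_pos.1 ((abs_nonneg _).trans_lt h)
  have hratio : |(x - x₀) / (y - x₀)| < 1 := by rwa [abs_div, div_lt_one (abs_pos.2 hy)]
  have hsum : (1 - (x - x₀) / (y - x₀))⁻¹ * (y - x₀)⁻¹ = (y - x)⁻¹ := by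
    rw [← mul_inv, sub_mul, one_mul, div_mul_cancel₀ _ hy, sub_sub_sub_cancel_right]
  simpa only [pow_mul_inv_pow_succ, hsum] using
    (hasSum_geometric_of_abs_lt_one hratio).mul_right (y - x₀)⁻¹

theorem norm_pow_mul_inv_pow_sub_le {c x₀ x y : ℝ} (hc : x₀ < c) (hy : c ≤ y) (n : ℕ) :
    ‖(x - x₀) ^ n * ((y - x₀) ^ (n + 1))⁻¹‖ ≤ (|x - x₀| / (c - x₀)) ^ n * (y - x₀)⁻¹ := by
  have : 0 < c - x₀ := sub_pos.2 hc
  have hyx : 0 < y - x₀ := by linarith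
  rw [norm_mul, norm_pow, Real.norm_eq_abs, Real.norm_of_nonneg (by positivity),
    pow_mul_inv_pow_succ]
  gcongr

variable {β : Type*} [MeasurableSpace β] {μ : Measure β} {f : β → ℝ} {c x₀ x : ℝ}

theorem hasSum_integral_inv_sub (hf : AEMeasurable f μ) (hc : ∀ᵐ v ∂μ, c ≤ f v) (hx₀ : x₀ < c)
    (hint : Integrable (fun v => (f v - x₀)⁻¹) μ) (hx : |x - x₀| < c - x₀) :
    HasSum (fun n : ℕ => (x - x₀) ^ n * ∫ v, ((f v - x₀) ^ (n + 1))⁻¹ ∂μ)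
      (∫ v, (f v - x)⁻¹ ∂μ) := by
  set q := |x - x₀| / (c - x₀)
  have hcx : 0 < c - x₀ := sub_pos.2 hx₀
  have hq1 : q < 1 := (div_lt_one hcx).2 hx
  have hbound (n : ℕ) : ∀ᵐ v ∂μ,
      ‖(x - x₀) ^ n * ((f v - x₀) ^ (n + 1))⁻¹‖ ≤ q ^ n * (f v - x₀)⁻¹ :=
    hc.mono fun v hv => norm_pow_mul_inv_pow_sub_le hx₀ hv n
  have hterm (n : ℕ) : Integrable (fun v => (x - x₀) ^ n * ((f v - x₀) ^ (n + 1))⁻¹) μ :=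
    (hint.const_mul (q ^ n)).mono'
      (((hf.sub_const x₀).pow_const (n + 1)).inv.const_mul _).aestronglyMeasurable (hbound n)
  have hsum : Summable fun n : ℕ => ∫ v, ‖(x - x₀) ^ n * ((f v - x₀) ^ (n + 1))⁻¹‖ ∂μ := by
    refine Summable.of_nonneg_of_le (fun n => integral_nonneg fun v => norm_nonneg _)
      (fun n => ?_) ((summable_geometric_of_lt_one (by positivity) hq1).mul_right
        (∫ v, (f v - x₀)⁻¹ ∂μ))
    rw [← integral_const_mul]
    exact integral_mono_ae (hterm n).norm (hint.const_mul _) (hbound n)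
  have hlimit : ∫ v, ∑' n : ℕ, (x - x₀) ^ n * ((f v - x₀) ^ (n + 1))⁻¹ ∂μ =
      ∫ v, (f v - x)⁻¹ ∂μ := by
    refine integral_congr_ae (hc.mono fun v hv => (hasSum_pow_mul_inv_pow_sub ?_).tsum_eq)
    exact hx.trans_le ((sub_le_sub_right hv x₀).trans (le_abs_self _))
  have := hasSum_integral_of_summable_integral_norm hterm hsum
  simpa only [integral_const_mul, hlimit] using this

theorem analyticOnNhd_integral_inv_sub (hf : AEMeasurable f μ) (hc : ∀ᵐ v ∂μ, c ≤ f v)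
    (hint : ∀ x < c, Integrable (fun v => (f v - x)⁻¹) μ) :
    AnalyticOnNhd ℝ (fun x => ∫ v, (f v - x)⁻¹ ∂μ) (Iio c) := by
  intro x₀ (hx₀ : x₀ < c)
  refine ⟨FormalMultilinearSeries.ofScalars ℝ
    fun n => ∫ v, ((f v - x₀) ^ (n + 1))⁻¹ ∂μ, hasFPowerSeriesAt_iff.2 ?_⟩
  filter_upwards [Metric.ball_mem_nhds (0 : ℝ) (sub_pos.2 hx₀)] with z hz
  have := hasSum_integral_inv_sub hf hc hx₀ (hint x₀ hx₀) (x := x₀ + z) (by simpa using hz)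
  simpa [FormalMultilinearSeries.coeff_ofScalars] using this

end CauchyTransform

theorem ae_one_le_rpow {a : ℝ} (ha : 0 ≤ a) : ∀ᵐ v ∂volume.restrict (Ioi (1 : ℝ)), 1 ≤ v ^ a :=
  ae_restrict_of_forall_mem measurableSet_Ioi fun _ hv => Real.one_le_rpow (le_of_lt hv) ha

theorem integrableOn_inv_rpow_sub {a x : ℝ} (ha : 1 < a) (hx : x < 1) :
    IntegrableOn (fun v : ℝ => (v ^ a - x)⁻¹) (Ioi 1) := by
  have hdom : IntegrableOn (fun v : ℝ => (min 1 (1 - x))⁻¹ * v ^ (-a)) (Ioi 1) :=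
    (integrableOn_Ioi_rpow_of_lt (by linarith) one_pos).const_mul _
  refine hdom.mono' (by fun_prop) (ae_restrict_of_forall_mem measurableSet_Ioi fun v hv => ?_)
  have hv1 : (1 : ℝ) < v := hv
  have hpow : 1 ≤ v ^ a := Real.one_le_rpow hv1.le (by linarith)
  have hle : min 1 (1 - x) * v ^ a ≤ v ^ a - x := by
    rcases le_total x 0 with h | h
    · nlinarith [min_le_left 1 (1 - x)]
    · nlinarith [min_le_right 1 (1 - x)]
  rw [Real.norm_of_nonneg (inv_nonneg.2 (by linarith)), Real.rpow_neg (by linarith), ← mul_inv]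
  exact inv_anti₀ (mul_pos (lt_min one_pos (by linarith)) (by positivity)) hle

theorem ascPochhammer_eval_mul_add (x : ℝ) (n : ℕ) :
    (ascPochhammer ℝ n).eval x * (x + n) = x * (ascPochhammer ℝ n).eval (x + 1) := by
  rw [← ascPochhammer_succ_eval, ascPochhammer_succ_left]
  simp

theorem ordinaryHypergeometric_one_neg {b : ℝ} (hb0 : b ≠ 0) (hb : b < 1) (y : ℝ) :
    ₂F₁ (1 : ℝ) (-b) (1 - b) y = ∑' n : ℕ, -b / (n - b) * y ^ n := by
  rw [ordinaryHypergeometric_eq_tsum]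
  refine tsum_congr fun n => ?_
  rw [smul_eq_mul, ascPochhammer_eval_one]
  congr 1
  rcases Nat.eq_zero_or_pos n with rfl | hn
  · simp [hb0]
  have hn1 : (1 : ℝ) ≤ n := by exact_mod_cast hn
  have hfact : (n.factorial : ℝ) ≠ 0 := by positivity
  have hden : (ascPochhammer ℝ n).eval (1 - b) ≠ 0 := (ascPochhammer_pos n _ (by linarith)).ne'
  have hshift := ascPochhammer_eval_mul_add (-b) n
  rw [neg_add_eq_sub, neg_add_eq_sub] at hshift
  rw [inv_mul_cancel₀ hfact, one_mul, ← div_eq_mul_inv, div_eq_div_iff hden (by linarith), hshift]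

theorem integral_inv_rpow_pow {a : ℝ} (ha : 1 < a) (n : ℕ) :
    ∫ v in Ioi (1 : ℝ), ((v ^ a) ^ (n + 1))⁻¹ = 1 / (a * (n + 1) - 1) := by
  have hexp : -(a * (n + 1)) < -1 := by nlinarith [(Nat.cast_nonneg n : (0 : ℝ) ≤ n)]
  have hpow : ∀ v ∈ Ioi (1 : ℝ), ((v ^ a) ^ (n + 1))⁻¹ = v ^ (-(a * (n + 1))) := fun v hv => by
    have hv0 : (0 : ℝ) ≤ v := zero_le_one.trans (le_of_lt hv)
    rw [Real.rpow_neg hv0, Real.rpow_mul hv0, ← Real.rpow_natCast, Nat.cast_succ]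
  rw [setIntegral_congr_fun measurableSet_Ioi hpow, integral_Ioi_rpow_of_lt hexp one_pos,
    Real.one_rpow, neg_div, ← div_neg]
  congr 1
  ring

theorem hasSum_one_sub_mul_integral_inv_rpow_sub {a y : ℝ} (ha : 1 < a) (hy : |y| < 1) :
    HasSum (fun n : ℕ => -(1 / a) / (n - 1 / a) * y ^ n)
      (1 - y * ∫ v in Ioi (1 : ℝ), (v ^ a - y)⁻¹) := by
  have hint := integrableOn_inv_rpow_sub ha one_pos
  have h := hasSum_integral_inv_sub (by fun_prop) (ae_one_le_rpow (by linarith)) one_pos hint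
    (x := y) (by simpa using hy)
  simp only [sub_zero, integral_inv_rpow_pow ha] at h
  have hcoeff (n : ℕ) : -(1 / a) / ((n + 1 : ℕ) - 1 / a) = -(1 / (a * (n + 1) - 1)) := by
    have : a * ((n : ℝ) + 1) - 1 ≠ 0 := by nlinarith [(Nat.cast_nonneg n : (0 : ℝ) ≤ n)]
    have hden : ((n + 1 : ℕ) - 1 / a : ℝ) = (a * (n + 1) - 1) / a := by push_cast; field_simp
    rw [hden]
    field_simp
  rw [← hasSum_nat_add_iff' 1]
  convert (h.mul_left y).neg using 1
  · funext n
    rw [hcoeff]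
    ring
  · have : a ≠ 0 := by linarith
    simp [this]

theorem gauss2F1_one_neg {a x : ℝ} (ha : 1 < a) (hx : x < 1) :
    gauss2F1 1 (-(1 / a)) (1 - 1 / a) x = 1 - x * ∫ v in Ioi (1 : ℝ), (v ^ a - x)⁻¹ := by
  have ha0 : 0 < a := one_pos.trans ha
  refine gauss2F1_eq (F := fun x => 1 - x * ∫ v in Ioi (1 : ℝ), (v ^ a - x)⁻¹) ?_ ?_ hx
  · exact analyticOnNhd_const.sub (analyticOnNhd_id.mul (analyticOnNhd_integral_inv_sub
      (by fun_prop) (ae_one_le_rpow ha0.le) fun _ => integrableOn_inv_rpow_sub ha))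
  · intro y hy
    rw [ordinaryHypergeometric_one_neg (by positivity) ((div_lt_one ha0).2 ha)]
    exact (hasSum_one_sub_mul_integral_inv_rpow_sub ha hy).tsum_eq.symm

theorem eta_one_eq {α s r : ℝ} (hα : 2 < α) (hs : 0 ≤ s / r ^ α) :
    eta α s 1 r = 1 + ∫ v in Ioi (1 : ℝ), (s / r ^ α) * (v ^ (α / 2) + s / r ^ α)⁻¹ := by
  have h : (2 : ℝ) / α = 1 / (α / 2) := by rw [one_div_div]
  rw [eta, one_mul, h, gauss2F1_one_neg (by linarith) (by linarith), integral_const_mul]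
  simp only [sub_neg_eq_add]
  ring

/-! ### The exponential function of an extended nonnegative number -/

/-- `exp (-s)` for `s ∈ [0, ∞]`, with value `0` at `∞`: the avoidance probability of a Poisson
process whose mean measure has total mass `s`. -/
noncomputable def expNeg (s : ℝ≥0∞) : ℝ≥0∞ := EReal.exp (-(s : EReal))

theorem expNeg_zero : expNeg 0 = 1 := by simp [expNeg]

theorem expNeg_ofReal {x : ℝ} (hx : 0 ≤ x) :
    expNeg (ENNReal.ofReal x) = ENNReal.ofReal (Real.exp (-x)) := by
  rw [expNeg, EReal.coe_ennreal_ofReal, max_eq_left hx, ← EReal.coe_neg, EReal.exp_coe]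

theorem expNeg_le_one (s : ℝ≥0∞) : expNeg s ≤ 1 := by
  simp [expNeg, EReal.exp_le_one_iff, EReal.coe_ennreal_nonneg]

theorem antitone_expNeg : Antitone expNeg := fun _ _ h =>
  EReal.exp_monotone (EReal.neg_le_neg_iff.2 (EReal.coe_ennreal_le_coe_ennreal_iff.2 h))

theorem continuous_expNeg : Continuous expNeg :=
  ENNReal.continuous_exp.comp (continuous_neg.comp continuous_coe_ennreal_ereal)

theorem expNeg_add (a b : ℝ≥0∞) : expNeg (a + b) = expNeg a * expNeg b := by
  have hexp (c : ℝ≥0∞) : EReal.exp c ≠ 0 := by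
    rw [Ne, EReal.exp_eq_zero_iff]
    exact EReal.coe_ennreal_ne_bot c
  rw [expNeg, expNeg, expNeg, EReal.exp_neg, EReal.exp_neg, EReal.exp_neg, EReal.coe_ennreal_add,
    EReal.exp_add, ENNReal.mul_inv (Or.inl (hexp a)) (Or.inr (hexp b))]

section Products

variable {ι : Type*}

theorem expNeg_sum (s : Finset ι) (u : ι → ℝ≥0∞) :
    expNeg (∑ j ∈ s, u j) = ∏ j ∈ s, expNeg (u j) := by
  induction s using Finset.cons_induction with
  | empty => simp [expNeg_zero]
  | cons a s ha ih => rw [Finset.sum_cons, Finset.prod_cons, expNeg_add, ih]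

theorem expNeg_tsum (u : ι → ℝ≥0∞) : expNeg (∑' j, u j) = ∏' j, expNeg (u j) := by
  have h : HasProd (fun j => expNeg (u j)) (expNeg (∑' j, u j)) := by
    simpa only [HasProd, ← expNeg_sum, Function.comp_def] using
      (continuous_expNeg.tendsto _).comp ENNReal.summable.hasSum
  exact h.tprod_eq.symm

theorem tprod_le_tprod_of_le_one {u v : ι → ℝ≥0∞} (huv : ∀ j, u j ≤ v j) (hv : ∀ j, v j ≤ 1) :
    ∏' j, u j ≤ ∏' j, v j :=
  (ENNReal.multipliable_of_le_one fun j => (huv j).trans (hv j)).tprod_le_tprod huv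
    (ENNReal.multipliable_of_le_one hv)

theorem tendsto_prod_erase {κ : Type*} {l : Filter κ} {S : κ → Finset ℕ} (hS : Tendsto S l atTop)
    {u : ℕ → ℝ≥0∞} (hu : ∀ j, u j ≤ 1) (i : ℕ) :
    Tendsto (fun L => ∏ j ∈ (S L).erase i, u j) l (𝓝 (∏' j : {j : ℕ // j ≠ i}, u j)) := by
  have hle (j : ℕ) : mulIndicator {j | j ≠ i} u j ≤ 1 := mulIndicator_apply_le' (fun _ => hu j)
    fun _ => le_rfl
  rw [show ∏' j : {j : ℕ // j ≠ i}, u j = ∏' j, mulIndicator {j | j ≠ i} u j from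
    tprod_subtype {j | j ≠ i} u]
  refine ((ENNReal.multipliable_of_le_one hle).hasProd.comp hS).congr fun L => ?_
  simp only [Function.comp_apply, mulIndicator_apply, mem_ofPred_eq, ← Finset.prod_filter]
  exact Finset.prod_congr (Finset.filter_ne' _ _) fun _ _ => rfl

theorem lintegral_tprod_of_iIndepFun {Ω : Type*} [MeasurableSpace Ω] {P : Measure Ω}
    [Countable ι] {u : ι → Ω → ℝ≥0∞} (hu : ∀ j, Measurable (u j)) (hle : ∀ j ω, u j ω ≤ 1)
    (hind : iIndepFun u P) : ∫⁻ ω, ∏' j, u j ω ∂P = ∏' j, ∫⁻ ω, u j ω ∂P := by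
  have := hind.isProbabilityMeasure
  refine (HasProd.tprod_eq ?_).symm
  simp only [HasProd, ← lintegral_prod_eq_prod_lintegral_of_indepFun _ _ hind hu]
  refine tendsto_lintegral_filter_of_dominated_convergence 1
    (.of_forall fun s => Finset.measurable_prod s fun j _ => hu j)
    (.of_forall fun s => ae_of_all _ fun ω => Finset.prod_le_one' fun j _ => hle j ω)
    (by simp) (ae_of_all _ fun ω => ?_)
  exact (ENNReal.multipliable_of_le_one fun j => hle j ω).hasProd

end Products

/-! ### Poisson counts -/

theorem lintegral_pow_poissonMeasure (r : ℝ≥0) {w : ℝ≥0∞} (hw : w ≤ 1) :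
    ∫⁻ n : ℕ, w ^ n ∂poissonMeasure r = expNeg (r * (1 - w)) := by
  lift w to ℝ≥0 using ne_top_of_le_ne_top ENNReal.one_ne_top hw
  have h := (NormedSpace.expSeries_div_hasSum_exp ((r : ℝ) * w)).mul_left (Real.exp (-r))
  have hw1 : (w : ℝ) ≤ 1 := by exact_mod_cast hw
  have hexp : (r : ℝ≥0∞) * (1 - w) = ENNReal.ofReal (r * (1 - w)) := by
    rw [ENNReal.ofReal_mul r.coe_nonneg, ENNReal.ofReal_coe_nnreal,
      ENNReal.ofReal_sub _ w.coe_nonneg, ENNReal.ofReal_one, ENNReal.ofReal_coe_nnreal]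
  rw [← Real.exp_eq_exp_ℝ, ← Real.exp_add] at h
  rw [hexp, expNeg_ofReal (mul_nonneg r.coe_nonneg (by linarith)), lintegral_countable',
    show -((r : ℝ) * (1 - w)) = -r + r * w by ring, ← h.tsum_eq,
    ENNReal.ofReal_tsum_of_nonneg (fun n => by positivity) h.summable]
  refine tsum_congr fun n => ?_
  rw [poissonMeasure_singleton, ← ENNReal.ofReal_coe_nnreal,
    ← ENNReal.ofReal_pow w.coe_nonneg, ← ENNReal.ofReal_mul (by positivity)]
  congr 1
  rw [mul_pow]
  ring

theorem poissonMeasure_succ_mul (r : ℝ≥0) (n : ℕ) :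
    ((n + 1 : ℕ) : ℝ≥0∞) * poissonMeasure r {n + 1} = r * poissonMeasure r {n} := by
  rw [poissonMeasure_singleton, poissonMeasure_singleton, ← ENNReal.ofReal_natCast,
    ← ENNReal.ofReal_coe_nnreal, ← ENNReal.ofReal_mul (by positivity),
    ← ENNReal.ofReal_mul (by positivity), Nat.factorial_succ]
  congr 1
  push_cast
  field_simp
  ring

theorem lintegral_mul_pow_poissonMeasure (r : ℝ≥0) {w : ℝ≥0∞} (hw : w ≤ 1) :
    ∫⁻ n : ℕ, n * w ^ (n - 1) ∂poissonMeasure r = r * expNeg (r * (1 - w)) := by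
  rw [lintegral_countable', tsum_eq_zero_add' ENNReal.summable,
    ← lintegral_pow_poissonMeasure r hw, lintegral_countable', ← ENNReal.tsum_mul_left]
  simp only [Nat.cast_zero, zero_mul, zero_add, Nat.add_sub_cancel]
  refine tsum_congr fun n => ?_
  rw [mul_right_comm, poissonMeasure_succ_mul]
  ring

section Counts

theorem measure_singleton_top (m : Measure ℕ∞) [IsProbabilityMeasure m] :
    m {⊤} = 1 - ∑' n : ℕ, m {(n : ℕ∞)} := by
  have hrange : ({⊤} : Set ℕ∞) = (⋃ n : ℕ, {(n : ℕ∞)})ᶜ := by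
    ext x
    simp
  rw [hrange, prob_compl_eq_one_sub (.iUnion fun n => measurableSet_singleton _),
    measure_iUnion (fun m n hmn => by simpa using hmn) fun n => measurableSet_singleton _]

variable {Ω : Type*} [MeasurableSpace Ω] {P : Measure Ω} [IsProbabilityMeasure P] {N : Ω → ℕ∞}
  {ν : Measure ℕ} [IsProbabilityMeasure ν]

theorem map_eq_map_natCast (hN : Measurable N) (hlaw : ∀ n : ℕ, P {ω | N ω = n} = ν {n}) :
    P.map N = ν.map (Nat.cast : ℕ → ℕ∞) := by
  have := Measure.isProbabilityMeasure_map (μ := P) hN.aemeasurable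
  have := Measure.isProbabilityMeasure_map (μ := ν) (f := (Nat.cast : ℕ → ℕ∞))
    (measurable_of_countable _).aemeasurable
  have hnat (n : ℕ) : P.map N {(n : ℕ∞)} = ν.map (Nat.cast : ℕ → ℕ∞) {(n : ℕ∞)} := by
    rw [Measure.map_apply hN (measurableSet_singleton _), Measure.map_apply
      (measurable_of_countable _) (measurableSet_singleton _), ← image_singleton (f := Nat.cast),
      Nat.cast_injective.preimage_image, ← hlaw, image_singleton]
    rfl
  refine Measure.ext_of_singleton fun x => ?_
  induction x with
  | top => simp only [measure_singleton_top, hnat]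
  | coe n => exact hnat n

theorem lintegral_comp_count (hN : Measurable N) (hlaw : ∀ n : ℕ, P {ω | N ω = n} = ν {n})
    (φ : ℕ∞ → ℝ≥0∞) : ∫⁻ ω, φ (N ω) ∂P = ∫⁻ n : ℕ, φ n ∂ν := by
  rw [← lintegral_map (measurable_of_countable φ) hN, map_eq_map_natCast hN hlaw,
    lintegral_map (measurable_of_countable φ) (measurable_of_countable _)]

theorem ae_count_ne_top (hN : Measurable N) (hlaw : ∀ n : ℕ, P {ω | N ω = n} = ν {n}) :
    ∀ᵐ ω ∂P, N ω ≠ ⊤ := by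
  refine ae_of_ae_map (p := fun n => n ≠ ⊤) hN.aemeasurable ?_
  rw [map_eq_map_natCast hN hlaw, ae_map_iff (measurable_of_countable _).aemeasurable
    (Set.to_countable _).measurableSet]
  exact ae_of_all _ ENat.natCast_ne_top

end Counts

theorem measurable_encard_setOf_mem {Ω ι E : Type*} [MeasurableSpace Ω] [MeasurableSpace E]
    [Countable ι] {c : ι → Ω → E} {B : Set E} (hB : MeasurableSet B)
    (hc : ∀ i, Measurable (c i)) : Measurable fun ω => {i | c i ω ∈ B}.encard := by
  have hsum (ω : Ω) : ({i | c i ω ∈ B}.encard : ℝ≥0∞) = ∑' i, (c i ⁻¹' B).indicator 1 ω := by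
    rw [← ENNReal.tsum_set_one, tsum_subtype {i | c i ω ∈ B} fun _ => (1 : ℝ≥0∞)]
    rfl
  have hmeas : Measurable fun ω => ({i | c i ω ∈ B}.encard : ℝ≥0∞) := by
    simp only [hsum]
    exact .tsum fun i => measurable_one.indicator (hc i hB)
  refine measurable_to_countable' fun n => ?_
  convert hmeas (measurableSet_singleton (n : ℝ≥0∞)) using 1
  ext ω
  simp

/-! ### Sums over the points of a cell -/

/-- The points of the plane are sorted into cells numbered by `ℕ`, `c i` being the cell of the
`i`-th point; the cells contain independent Poisson numbers of points, each with mean `r`. -/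
structure IsPoissonCells {Ω : Type*} [MeasurableSpace Ω] (P : Measure Ω) (r : ℝ≥0)
    (c : ℕ → Ω → ℕ) : Prop where
  measurable : ∀ i, Measurable (c i)
  count_law : ∀ l n : ℕ, P {ω | {i | c i ω = l}.encard = n} = poissonMeasure r {n}
  count_indep : iIndepFun (fun (l : ℕ) ω => {i | c i ω = l}.encard) P

/-- The contribution of cell `l`, containing `n` points of weight `w`, to the sum over the points
of cell `k` of the products of the weights of all other points. -/
noncomputable def cellFactor (k : ℕ) (w : ℝ≥0∞) (l : ℕ) (n : ℕ∞) : ℝ≥0∞ :=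
  if l = k then n.toNat * w ^ (n.toNat - 1) else w ^ n.toNat

theorem prod_erase_eq_prod_range_erase {c : ℕ → ℕ} (hfin : ∀ l, {i | c i = l}.Finite) {L : ℕ}
    {S : Finset ℕ} (hS : ∀ i, i ∈ S ↔ c i < L) {i : ℕ} (hi : c i < L) (w : ℕ → ℝ≥0∞) :
    ∏ j ∈ S.erase i, w (c j) = w (c i) ^ ((hfin (c i)).toFinset.card - 1) *
      ∏ l ∈ (Finset.range L).erase (c i), w l ^ (hfin l).toFinset.card := by
  have hmaps : ∀ j ∈ S.erase i, c j ∈ Finset.range L := fun j hj =>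
    Finset.mem_range.2 ((hS j).1 (Finset.mem_of_mem_erase hj))
  have hown : {j ∈ S.erase i | c j = c i} = (hfin (c i)).toFinset.erase i := by
    ext j
    simp only [Finset.mem_filter, Finset.mem_erase, hS, Finite.mem_toFinset, mem_ofPred_eq]
    grind
  have hother : ∀ l ∈ (Finset.range L).erase (c i),
      {j ∈ S.erase i | c j = l} = (hfin l).toFinset := fun l hl => by
    ext j
    simp only [Finset.mem_filter, Finset.mem_erase, hS, Finite.mem_toFinset, mem_ofPred_eq]
    grind
  rw [← Finset.prod_fiberwise_of_maps_to' hmaps, ← Finset.mul_prod_erase _ _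
    (Finset.mem_range.2 hi)]
  simp only [Finset.prod_const]
  rw [hown, Finset.card_erase_of_mem (by simp),
    Finset.prod_congr rfl fun l hl => by rw [hother l hl]]

theorem sum_prod_erase_eq_prod_cellFactor {c : ℕ → ℕ} (hfin : ∀ l, {i | c i = l}.Finite) {L : ℕ}
    {S : Finset ℕ} (hS : ∀ i, i ∈ S ↔ c i < L) {k : ℕ} (hk : k < L) (w : ℕ → ℝ≥0∞) :
    ∑ i ∈ (hfin k).toFinset, ∏ j ∈ S.erase i, w (c j) =
      ∏ l ∈ Finset.range L, cellFactor k (w l) l {i | c i = l}.encard := by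
  have hcard (l : ℕ) : {i | c i = l}.encard.toNat = (hfin l).toFinset.card := by
    rw [(hfin l).encard_eq_coe_toFinset_card, ENat.toNat_natCast]
  have hterm : ∀ i ∈ (hfin k).toFinset, ∏ j ∈ S.erase i, w (c j) =
      w k ^ ((hfin k).toFinset.card - 1) *
        ∏ l ∈ (Finset.range L).erase k, w l ^ (hfin l).toFinset.card := fun i hi => by
    obtain rfl : c i = k := (hfin k).mem_toFinset.1 hi
    exact prod_erase_eq_prod_range_erase hfin hS hk w
  rw [Finset.sum_congr rfl hterm, Finset.sum_const, nsmul_eq_mul,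
    ← Finset.mul_prod_erase _ _ (Finset.mem_range.2 hk), cellFactor, if_pos rfl, hcard, mul_assoc]
  congr 2
  refine Finset.prod_congr rfl fun l hl => ?_
  rw [cellFactor, if_neg (Finset.ne_of_mem_erase hl), hcard]

theorem prod_cellFactor_le {w : ℕ → ℝ≥0∞} (hw : ∀ l, w l ≤ 1) {k L : ℕ} (hk : k < L)
    (n : ℕ → ℕ∞) :
    ∏ l ∈ Finset.range L, cellFactor k (w l) l (n l) ≤ (n k).toNat := by
  rw [← Finset.mul_prod_erase _ _ (Finset.mem_range.2 hk), cellFactor, if_pos rfl, mul_assoc]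
  refine mul_le_of_le_one_right zero_le (mul_le_one' (pow_le_one' (hw k) _) ?_)
  refine Finset.prod_le_one' fun l hl => ?_
  rw [cellFactor, if_neg (Finset.ne_of_mem_erase hl)]
  exact pow_le_one' (hw l) _

theorem tendsto_prod_cellFactor {c : ℕ → ℕ} (hfin : ∀ l, {i | c i = l}.Finite) {w : ℕ → ℝ≥0∞}
    (hw : ∀ l, w l ≤ 1) (k : ℕ) :
    Tendsto (fun L => ∏ l ∈ Finset.range L, cellFactor k (w l) l {i | c i = l}.encard) atTop
      (𝓝 (∑' i, if c i = k then ∏' j : {j : ℕ // j ≠ i}, w (c j) else 0)) := by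
  have hfin' (L : ℕ) : {i | c i < L}.Finite := by
    have : {i | c i < L} = ⋃ l ∈ Iio L, {i | c i = l} := by ext; simp
    exact this ▸ (finite_Iio L).biUnion fun l _ => hfin l
  set S : ℕ → Finset ℕ := fun L => (hfin' L).toFinset
  have hS : Tendsto S atTop atTop := by
    refine tendsto_atTop_finset_of_monotone (fun L M hLM i => ?_) fun i => ⟨c i + 1, ?_⟩
    · simpa [S] using fun h => lt_of_lt_of_le h hLM
    · simp [S]
  have hsum : ∑' i, (if c i = k then ∏' j : {j : ℕ // j ≠ i}, w (c j) else 0) =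
      ∑ i ∈ (hfin k).toFinset, ∏' j : {j : ℕ // j ≠ i}, w (c j) := by
    rw [tsum_eq_sum (s := (hfin k).toFinset) fun i hi => if_neg (by simpa using hi)]
    exact Finset.sum_congr rfl fun i hi => if_pos (by simpa using hi)
  rw [hsum]
  refine (tendsto_finsetSum _ fun i _ => tendsto_prod_erase hS (fun j => hw (c j)) i).congr' ?_
  filter_upwards [eventually_gt_atTop k] with L hL
  exact sum_prod_erase_eq_prod_cellFactor hfin (by simp [S]) hL w

namespace IsPoissonCells

variable {Ω : Type*} [MeasurableSpace Ω] {P : Measure Ω} {r : ℝ≥0} {c : ℕ → Ω → ℕ}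

theorem measurable_count (hc : IsPoissonCells P r c) (l : ℕ) :
    Measurable fun ω => {i | c i ω = l}.encard :=
  measurable_encard_setOf_mem (measurableSet_singleton l) hc.measurable

theorem lintegral_prod_cellFactor (hc : IsPoissonCells P r c) {w : ℕ → ℝ≥0∞}
    (hw : ∀ l, w l ≤ 1) {k L : ℕ} (hk : k < L) :
    ∫⁻ ω, ∏ l ∈ Finset.range L, cellFactor k (w l) l {i | c i ω = l}.encard ∂P =
      r * expNeg (∑ l ∈ Finset.range L, r * (1 - w l)) := by
  have := hc.count_indep.isProbabilityMeasure
  have hmeas (l : ℕ) : Measurable (cellFactor k (w l) l) := measurable_of_countable _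
  have hfactor (l : ℕ) : ∫⁻ ω, cellFactor k (w l) l {i | c i ω = l}.encard ∂P =
      (if l = k then (r : ℝ≥0∞) else 1) * expNeg (r * (1 - w l)) := by
    rw [lintegral_comp_count (hc.measurable_count l) (hc.count_law l)]
    simp only [cellFactor, ENat.toNat_natCast]
    split_ifs
    · exact lintegral_mul_pow_poissonMeasure r (hw l)
    · rw [lintegral_pow_poissonMeasure r (hw l), one_mul]
  rw [lintegral_prod_eq_prod_lintegral_of_indepFun _
      (fun l ω => cellFactor k (w l) l {i | c i ω = l}.encard)
      (hc.count_indep.comp _ hmeas) fun l => (hmeas l).comp (hc.measurable_count l)]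
  simp only [hfactor, Finset.prod_mul_distrib, expNeg_sum]
  rw [Finset.prod_ite_eq', if_pos (Finset.mem_range.2 hk)]

theorem lintegral_cell (hc : IsPoissonCells P r c) {w : ℕ → ℝ≥0∞} (hw : ∀ l, w l ≤ 1) (k : ℕ) :
    ∫⁻ ω, ∑' i, (if c i ω = k then ∏' j : {j : ℕ // j ≠ i}, w (c j ω) else 0) ∂P =
      r * expNeg (r * ∑' l, (1 - w l)) := by
  have := hc.count_indep.isProbabilityMeasure
  have hmeas (l : ℕ) : Measurable fun ω => cellFactor k (w l) l {i | c i ω = l}.encard :=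
    (measurable_of_countable (cellFactor k (w l) l)).comp (hc.measurable_count l)
  have hfin : ∀ᵐ ω ∂P, ∀ l, {i | c i ω = l}.Finite := ae_all_iff.2 fun l =>
    (ae_count_ne_top (hc.measurable_count l) (hc.count_law l)).mono fun ω => encard_ne_top_iff.1
  have hmean : ∫⁻ ω, ({i | c i ω = k}.encard.toNat : ℝ≥0∞) ∂P = r := by
    rw [lintegral_comp_count (hc.measurable_count k) (hc.count_law k) fun n => (n.toNat : ℝ≥0∞)]
    simpa [expNeg_zero] using lintegral_mul_pow_poissonMeasure r le_rfl
  have hlim : Tendsto (fun L => ∫⁻ ω, ∏ l ∈ Finset.range L,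
      cellFactor k (w l) l {i | c i ω = l}.encard ∂P) atTop
      (𝓝 (∫⁻ ω, ∑' i, (if c i ω = k then ∏' j : {j : ℕ // j ≠ i}, w (c j ω) else 0) ∂P)) :=
    tendsto_lintegral_filter_of_dominated_convergence (fun ω => {i | c i ω = k}.encard.toNat)
      (.of_forall fun L => Finset.measurable_prod _ fun l _ => hmeas l)
      ((eventually_gt_atTop k).mono fun L hL => ae_of_all _ fun ω => prod_cellFactor_le hw hL _)
      (hmean ▸ ENNReal.coe_ne_top) (hfin.mono fun ω hω => tendsto_prod_cellFactor hω hw k)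
  rw [← ENNReal.tsum_mul_left]
  refine tendsto_nhds_unique hlim (Tendsto.congr' ?_ (ENNReal.Tendsto.const_mul
    ((continuous_expNeg.tendsto _).comp ENNReal.summable.hasSum.tendsto_sum_nat)
    (Or.inr ENNReal.coe_ne_top)))
  filter_upwards [eventually_gt_atTop k] with L hL
  simp only [hc.lintegral_prod_cellFactor hw hL, Function.comp_apply]

theorem lintegral_tsum_tprod_ne (hc : IsPoissonCells P r c) {w : ℕ → ℕ → ℝ≥0∞}
    (hw : ∀ k l, w k l ≤ 1) :
    ∫⁻ ω, ∑' i, ∏' j : {j : ℕ // j ≠ i}, w (c i ω) (c j ω) ∂P =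
      ∑' k, r * expNeg (r * ∑' l, (1 - w k l)) := by
  have hcells (ω : Ω) : ∑' i, ∏' j : {j : ℕ // j ≠ i}, w (c i ω) (c j ω) =
      ∑' k, ∑' i, if c i ω = k then ∏' j : {j : ℕ // j ≠ i}, w k (c j ω) else 0 := by
    rw [ENNReal.tsum_comm]
    refine tsum_congr fun i => ?_
    rw [tsum_eq_single (c i ω) fun k hk => if_neg hk.symm, if_pos rfl]
  simp only [hcells]
  rw [lintegral_tsum fun k => (Measurable.tsum fun i => ?_).aemeasurable]
  · exact tsum_congr fun k => hc.lintegral_cell (hw k) k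
  · exact .ite (hc.measurable i (measurableSet_singleton k))
      (.tprod fun j => (measurable_of_countable (w k)).comp (hc.measurable j)) measurable_const

end IsPoissonCells

/-! ### Annuli of equal area -/

section SumIntegral

variable {δ : ℝ} {e : ℝ → ℝ≥0∞}

theorem tsum_lintegral_Ioc (hδ : 0 < δ) (e : ℝ → ℝ≥0∞) :
    ∑' k : ℕ, ∫⁻ s in Ioc (k * δ) ((k + 1) * δ), e s = ∫⁻ s in Ioi 0, e s := by
  have hmono : Monotone fun k : ℕ => (k : ℝ) * δ := fun m n h => by dsimp only; gcongr
  have hunbounded : ¬ BddAbove (range fun k : ℕ => (k : ℝ) * δ) :=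
    not_bddAbove_of_tendsto_atTop (tendsto_natCast_atTop_atTop.atTop_mul_const hδ)
  have hdisj := hmono.pairwise_disjoint_on_Ioc_succ
  have hunion := iUnion_Ioc_map_succ_eq_Ioi
    (f := fun k : ℕ => (k : ℝ) * δ) (fun k => by simpa using by positivity) hunbounded
  simp only [Order.succ_eq_add_one, Nat.cast_add, Nat.cast_one, Nat.bot_eq_zero,
    Nat.cast_zero, zero_mul] at hdisj hunion
  rw [← hunion, lintegral_iUnion (fun _ => measurableSet_Ioc) hdisj]

theorem lintegral_Ioc_const (δ : ℝ) (x : ℝ) (a : ℝ≥0∞) :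
    ∫⁻ _ in Ioc (x * δ) ((x + 1) * δ), a = ENNReal.ofReal δ * a := by
  rw [setLIntegral_const, Real.volume_Ioc, mul_comm, add_one_mul, add_sub_cancel_left]

theorem tsum_succ_le_lintegral (hδ : 0 < δ) (he : AntitoneOn e (Ici 0)) :
    ∑' k : ℕ, ENNReal.ofReal δ * e ((k + 1) * δ) ≤ ∫⁻ s in Ioi 0, e s := by
  rw [← tsum_lintegral_Ioc hδ]
  refine ENNReal.tsum_le_tsum fun k => ?_
  rw [← lintegral_Ioc_const δ k]
  refine setLIntegral_mono' measurableSet_Ioc fun s hs => ?_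
  have : 0 ≤ k * δ := by positivity
  exact he (this.trans hs.1.le) (this.trans (hs.1.le.trans hs.2)) hs.2

theorem lintegral_le_tsum (hδ : 0 < δ) (he : AntitoneOn e (Ici 0)) :
    ∫⁻ s in Ioi 0, e s ≤ ∑' k : ℕ, ENNReal.ofReal δ * e (k * δ) := by
  rw [← tsum_lintegral_Ioc hδ]
  refine ENNReal.tsum_le_tsum fun k => ?_
  rw [← lintegral_Ioc_const δ k]
  refine setLIntegral_mono' measurableSet_Ioc fun s hs => ?_
  have : 0 ≤ k * δ := by positivity
  exact he this (this.trans hs.1.le) hs.1.le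

theorem tsum_le_add_tsum_succ (δ : ℝ) (he : e 0 ≤ 1) :
    ∑' k : ℕ, ENNReal.ofReal δ * e (k * δ) ≤
      ENNReal.ofReal δ + ∑' k : ℕ, ENNReal.ofReal δ * e ((k + 1) * δ) := by
  rw [tsum_eq_zero_add' ENNReal.summable]
  push_cast
  rw [zero_mul]
  gcongr
  exact mul_le_of_le_one_right' he

theorem tsum_le_add_lintegral (hδ : 0 < δ) (he : AntitoneOn e (Ici 0)) (he0 : e 0 ≤ 1) :
    ∑' k : ℕ, ENNReal.ofReal δ * e (k * δ) ≤ ENNReal.ofReal δ + ∫⁻ s in Ioi 0, e s :=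
  (tsum_le_add_tsum_succ δ he0).trans (by gcongr; exact tsum_succ_le_lintegral hδ he)

theorem lintegral_le_add_tsum_succ (hδ : 0 < δ) (he : AntitoneOn e (Ici 0)) (he0 : e 0 ≤ 1) :
    ∫⁻ s in Ioi 0, e s ≤ ENNReal.ofReal δ + ∑' k : ℕ, ENNReal.ofReal δ * e ((k + 1) * δ) :=
  (lintegral_le_tsum hδ he).trans (tsum_le_add_tsum_succ δ he0)

end SumIntegral

/-- The area of the disk around the origin with `x` on its boundary. It is the radial coordinate
in which a homogeneous Poisson process on the plane becomes one on the half-line. -/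
noncomputable def diskArea (x : Plane) : ℝ := Real.pi * ‖x‖ ^ 2

theorem diskArea_nonneg (x : Plane) : 0 ≤ diskArea x := by unfold diskArea; positivity

theorem measurable_diskArea : Measurable diskArea := by unfold diskArea; fun_prop

theorem diskArea_le_diskArea_iff {x y : Plane} : diskArea x ≤ diskArea y ↔ ‖x‖ ≤ ‖y‖ := by
  rw [diskArea, diskArea, mul_le_mul_iff_right₀ Real.pi_pos,
    pow_le_pow_iff_left₀ (norm_nonneg _) (norm_nonneg _) two_ne_zero]

/-- The index `l` of the annulus `l * δ ≤ diskArea x < (l + 1) * δ` that contains `x`. -/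
noncomputable def annulusIndex (δ : ℝ) (x : Plane) : ℕ := ⌊diskArea x / δ⌋₊

theorem measurable_annulusIndex (δ : ℝ) : Measurable (annulusIndex δ) :=
  Nat.measurable_floor.comp (measurable_diskArea.div_const δ)

section Annuli

variable {δ : ℝ}

theorem annulusIndex_eq_iff (hδ : 0 < δ) {x : Plane} {l : ℕ} :
    annulusIndex δ x = l ↔ l * δ ≤ diskArea x ∧ diskArea x < (l + 1) * δ := by
  have := diskArea_nonneg x
  rw [annulusIndex, Nat.floor_eq_iff (by positivity), le_div_iff₀ hδ, div_lt_iff₀ hδ]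

theorem annulusIndex_mul_le (hδ : 0 < δ) (x : Plane) : annulusIndex δ x * δ ≤ diskArea x :=
  ((annulusIndex_eq_iff hδ).1 rfl).1

theorem le_annulusIndex_add_one_mul (hδ : 0 < δ) (x : Plane) :
    diskArea x ≤ (annulusIndex δ x + 1) * δ :=
  ((annulusIndex_eq_iff hδ).1 rfl).2.le

theorem diskArea_lt_iff {x : Plane} {y : ℝ} :
    diskArea x < y ↔ x ∈ Metric.ball 0 √(y / Real.pi) := by
  rw [mem_ball_zero_iff, Real.lt_sqrt (norm_nonneg _), lt_div_iff₀ Real.pi_pos, diskArea, mul_comm]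

theorem annulus_eq_sdiff (hδ : 0 < δ) (l : ℕ) :
    {x | annulusIndex δ x = l} = Metric.ball (0 : Plane) √((l + 1) * δ / Real.pi) \
      Metric.ball 0 √(l * δ / Real.pi) := by
  ext x
  rw [mem_ofPred_eq, annulusIndex_eq_iff hδ, Set.mem_sdiff, ← diskArea_lt_iff, ← diskArea_lt_iff,
    not_lt, and_comm]

theorem volume_real_ball_sqrt_div_pi {y : ℝ} (hy : 0 ≤ y) :
    volume.real (Metric.ball (0 : Plane) √(y / Real.pi)) = y := by
  rw [measureReal_def, EuclideanSpace.volume_ball_fin_two, ← ENNReal.ofReal_pow (by positivity),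
    ← ENNReal.ofReal_mul (by positivity), ENNReal.toReal_ofReal (by positivity),
    Real.sq_sqrt (by positivity), div_mul_cancel₀ _ Real.pi_ne_zero]

theorem volume_real_annulus (hδ : 0 < δ) (l : ℕ) :
    volume.real {x | annulusIndex δ x = l} = δ := by
  have hsub : Metric.ball (0 : Plane) √(l * δ / Real.pi) ⊆
      Metric.ball 0 √((l + 1) * δ / Real.pi) := by
    gcongr
    linarith
  rw [annulus_eq_sdiff hδ, measureReal_sdiff hsub measurableSet_ball,
    volume_real_ball_sqrt_div_pi (by positivity), volume_real_ball_sqrt_div_pi (by positivity)]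
  ring

theorem IsPoissonProcess.isPoissonCells {Ω : Type*} [MeasurableSpace Ω] {P : Measure Ω} {lam : ℝ}
    {X : ℕ → Ω → Plane} (hX : IsPoissonProcess P lam X) (hδ : 0 < δ) :
    IsPoissonCells P (Real.toNNReal (lam * δ)) fun i ω => annulusIndex δ (X i ω) := by
  have hmeas (l : ℕ) : MeasurableSet {x | annulusIndex δ x = l} :=
    measurable_annulusIndex δ (measurableSet_singleton l)
  have hbdd (l : ℕ) : Bornology.IsBounded {x | annulusIndex δ x = l} := by
    rw [annulus_eq_sdiff hδ]
    exact Metric.isBounded_ball.subset sdiff_subset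
  refine ⟨fun i => (measurable_annulusIndex δ).comp (hX.measurable i), fun l n => ?_, ?_⟩
  · have hlaw := hX.count_law _ (hmeas l) (hbdd l) n
    rwa [volume_real_annulus hδ] at hlaw
  · refine iIndepFun_iff_finset.2 fun s => ?_
    have hfin := hX.count_indep s.card (fun j => {x | annulusIndex δ x = s.equivFin.symm j})
      (fun j => hmeas _) (fun j => hbdd _) fun i j hij => Set.disjoint_left.2 fun x hi hj =>
        hij (s.equivFin.symm.injective (Subtype.ext (hi.symm.trans hj)))
    have hlabels := hfin.precomp s.equivFin.injective
    simp only [Equiv.symm_apply_apply] at hlabels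
    exact hlabels

end Annuli

/-! ### The Mecke formula for monotone radial kernels -/

/-- A kernel on `[0, ∞)²` with values in `[0, 1]`, decreasing in the first and increasing in the
second variable. Monotonicity is what allows the Mecke formula to be read off from the counts in
thin annuli. -/
structure IsMonotoneKernel (F : ℝ → ℝ → ℝ≥0∞) : Prop where
  le_one : ∀ {s t}, 0 ≤ s → 0 ≤ t → F s t ≤ 1
  antitoneOn_left : ∀ {t}, 0 ≤ t → AntitoneOn (fun s => F s t) (Ici 0)
  monotoneOn_right : ∀ {s}, 0 ≤ s → MonotoneOn (F s) (Ici 0)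

/-- The integral of `1 - F s`: conditionally on a point at radial coordinate `s`, the product of
`F s` over the points of a Poisson process of density `lam` has mean
`exp (-lam * kernelExponent F s)`. -/
noncomputable def kernelExponent (F : ℝ → ℝ → ℝ≥0∞) (s : ℝ) : ℝ≥0∞ := ∫⁻ t in Ioi 0, (1 - F s t)

/-- The sum over the points `x i` of the products, over all other points `x j`, of `F` at the
radial coordinates of `x i` and `x j`. -/
noncomputable def palmSum (F : ℝ → ℝ → ℝ≥0∞) (x : ℕ → Plane) : ℝ≥0∞ :=
  ∑' i, ∏' j : {j : ℕ // j ≠ i}, F (diskArea (x i)) (diskArea (x j))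

theorem expNeg_mul_expNeg_le {a b c : ℝ≥0∞} (h : a ≤ b + c) :
    expNeg b * expNeg c ≤ expNeg a := by
  rw [← expNeg_add]
  exact antitone_expNeg h

namespace IsMonotoneKernel

variable {F : ℝ → ℝ → ℝ≥0∞}

theorem antitoneOn_one_sub (hF : IsMonotoneKernel F) {s : ℝ} (hs : 0 ≤ s) :
    AntitoneOn (fun t => 1 - F s t) (Ici 0) :=
  fun _ ht _ ht' h => tsub_le_tsub_left (hF.monotoneOn_right hs ht ht' h) 1

theorem monotoneOn_kernelExponent (hF : IsMonotoneKernel F) :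
    MonotoneOn (kernelExponent F) (Ici 0) :=
  fun _ hs _ hs' h => setLIntegral_mono' measurableSet_Ioi fun _ ht =>
    tsub_le_tsub_left (hF.antitoneOn_left (le_of_lt ht) hs hs' h) 1

theorem antitoneOn_expNeg_kernelExponent (hF : IsMonotoneKernel F) (a : ℝ≥0∞) :
    AntitoneOn (fun s => expNeg (a * kernelExponent F s)) (Ici 0) :=
  fun _ hs _ hs' h => antitone_expNeg (by gcongr; exact hF.monotoneOn_kernelExponent hs hs' h)

variable {δ : ℝ}

theorem apply_diskArea_le (hF : IsMonotoneKernel F) (hδ : 0 < δ) (x y : Plane) :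
    F (diskArea x) (diskArea y) ≤ F (annulusIndex δ x * δ) ((annulusIndex δ y + 1) * δ) :=
  (hF.antitoneOn_left (diskArea_nonneg _) (mem_Ici.2 (by positivity)) (diskArea_nonneg _)
    (annulusIndex_mul_le hδ _)).trans
  (hF.monotoneOn_right (by positivity) (diskArea_nonneg _) (mem_Ici.2 (by positivity))
    (le_annulusIndex_add_one_mul hδ _))

theorem le_apply_diskArea (hF : IsMonotoneKernel F) (hδ : 0 < δ) (x y : Plane) :
    F ((annulusIndex δ x + 1) * δ) (annulusIndex δ y * δ) ≤ F (diskArea x) (diskArea y) :=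
  (hF.antitoneOn_left (by positivity) (diskArea_nonneg _) (mem_Ici.2 (by positivity))
    (le_annulusIndex_add_one_mul hδ _)).trans
  (hF.monotoneOn_right (diskArea_nonneg _) (mem_Ici.2 (by positivity)) (diskArea_nonneg _)
    (annulusIndex_mul_le hδ _))

theorem kernelExponent_le_add_tsum (hF : IsMonotoneKernel F) (hδ : 0 < δ) {s : ℝ} (hs : 0 ≤ s) :
    kernelExponent F s ≤
      ENNReal.ofReal δ + ENNReal.ofReal δ * ∑' l : ℕ, (1 - F s ((l + 1) * δ)) := by
  rw [← ENNReal.tsum_mul_left]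
  exact lintegral_le_add_tsum_succ hδ (hF.antitoneOn_one_sub hs) tsub_le_self

theorem tsum_le_add_kernelExponent (hF : IsMonotoneKernel F) (hδ : 0 < δ) {s : ℝ} (hs : 0 ≤ s) :
    ENNReal.ofReal δ * ∑' l : ℕ, (1 - F s (l * δ)) ≤ ENNReal.ofReal δ + kernelExponent F s := by
  rw [← ENNReal.tsum_mul_left]
  exact tsum_le_add_lintegral hδ (hF.antitoneOn_one_sub hs) tsub_le_self

end IsMonotoneKernel

section Mecke

variable {Ω : Type*} [MeasurableSpace Ω] {P : Measure Ω} {lam : ℝ} {X : ℕ → Ω → Plane}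
  {F : ℝ → ℝ → ℝ≥0∞} {δ : ℝ}

theorem IsPoissonProcess.lintegral_tsum_tprod_annulusIndex (hX : IsPoissonProcess P lam X)
    (hδ : 0 < δ) {w : ℕ → ℕ → ℝ≥0∞} (hw : ∀ k l, w k l ≤ 1) :
    ∫⁻ ω, ∑' i, ∏' j : {j : ℕ // j ≠ i}, w (annulusIndex δ (X i ω)) (annulusIndex δ (X j ω)) ∂P =
      ∑' k, ENNReal.ofReal lam * ENNReal.ofReal δ *
        expNeg (ENNReal.ofReal lam * ENNReal.ofReal δ * ∑' l, (1 - w k l)) := by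
  rw [← ENNReal.ofReal_mul' hδ.le]
  exact (hX.isPoissonCells hδ).lintegral_tsum_tprod_ne hw

theorem expNeg_mul_lintegral_palmSum_le (hX : IsPoissonProcess P lam X) (hF : IsMonotoneKernel F)
    (hδ : 0 < δ) :
    expNeg (ENNReal.ofReal lam * ENNReal.ofReal δ) * ∫⁻ ω, palmSum F (fun i => X i ω) ∂P ≤
      ENNReal.ofReal lam * (ENNReal.ofReal δ +
        ∫⁻ s in Ioi 0, expNeg (ENNReal.ofReal lam * kernelExponent F s)) := by
  let w : ℕ → ℕ → ℝ≥0∞ := fun k l => F (k * δ) ((l + 1) * δ)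
  have hw (k l : ℕ) : w k l ≤ 1 := hF.le_one (by positivity) (by positivity)
  have hcells := hX.lintegral_tsum_tprod_annulusIndex hδ hw
  have hle (ω : Ω) : palmSum F (fun i => X i ω) ≤ ∑' i, ∏' j : {j : ℕ // j ≠ i},
      w (annulusIndex δ (X i ω)) (annulusIndex δ (X j ω)) :=
    ENNReal.tsum_le_tsum fun _ => tprod_le_tprod_of_le_one
      (fun _ => hF.apply_diskArea_le hδ _ _) fun _ => hw _ _
  set a := ENNReal.ofReal lam
  set d := ENNReal.ofReal δ
  calc expNeg (a * d) * ∫⁻ ω, palmSum F (fun i => X i ω) ∂P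
      ≤ expNeg (a * d) * ∑' k, a * d * expNeg (a * d * ∑' l, (1 - w k l)) := by
        gcongr
        exact (lintegral_mono hle).trans_eq hcells
    _ = a * ∑' k, d * (expNeg (a * d) * expNeg (a * d * ∑' l, (1 - w k l))) := by
        simp only [← ENNReal.tsum_mul_left]
        exact tsum_congr fun k => by ring
    _ ≤ a * ∑' k : ℕ, d * expNeg (a * kernelExponent F (k * δ)) := by
        gcongr with k
        refine expNeg_mul_expNeg_le ?_
        rw [mul_assoc, ← mul_add]
        gcongr
        exact hF.kernelExponent_le_add_tsum hδ (by positivity)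
    _ ≤ a * (d + ∫⁻ s in Ioi 0, expNeg (a * kernelExponent F s)) := by
        gcongr
        exact tsum_le_add_lintegral hδ (hF.antitoneOn_expNeg_kernelExponent a) (expNeg_le_one _)

theorem expNeg_mul_lintegral_le_lintegral_palmSum (hX : IsPoissonProcess P lam X)
    (hF : IsMonotoneKernel F) (hδ : 0 < δ) :
    expNeg (ENNReal.ofReal lam * ENNReal.ofReal δ) * (ENNReal.ofReal lam *
        ∫⁻ s in Ioi 0, expNeg (ENNReal.ofReal lam * kernelExponent F s)) ≤
      ENNReal.ofReal lam * ENNReal.ofReal δ + ∫⁻ ω, palmSum F (fun i => X i ω) ∂P := by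
  let w : ℕ → ℕ → ℝ≥0∞ := fun k l => F ((k + 1) * δ) (l * δ)
  have hcells := hX.lintegral_tsum_tprod_annulusIndex hδ (w := w)
    fun k l => hF.le_one (by positivity) (by positivity)
  have hle (ω : Ω) : ∑' i, ∏' j : {j : ℕ // j ≠ i},
      w (annulusIndex δ (X i ω)) (annulusIndex δ (X j ω)) ≤ palmSum F (fun i => X i ω) :=
    ENNReal.tsum_le_tsum fun _ => tprod_le_tprod_of_le_one
      (fun _ => hF.le_apply_diskArea hδ _ _) fun _ =>
        hF.le_one (diskArea_nonneg _) (diskArea_nonneg _)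
  set a := ENNReal.ofReal lam
  set d := ENNReal.ofReal δ
  let e : ℝ → ℝ≥0∞ := fun s => expNeg (a * kernelExponent F s)
  calc expNeg (a * d) * (a * ∫⁻ s in Ioi 0, e s)
      ≤ expNeg (a * d) * (a * (d + ∑' k : ℕ, d * e ((k + 1) * δ))) := by
        gcongr
        exact lintegral_le_add_tsum_succ hδ (hF.antitoneOn_expNeg_kernelExponent a)
          (expNeg_le_one _)
    _ = expNeg (a * d) * (a * d) + ∑' k : ℕ, a * d * (expNeg (a * d) * e ((k + 1) * δ)) := by
        simp only [mul_add, ← ENNReal.tsum_mul_left]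
        congr 1
        exact tsum_congr fun k => by ring
    _ ≤ 1 * (a * d) + ∑' k, a * d * expNeg (a * d * ∑' l, (1 - w k l)) := by
        gcongr ?_ * _ + ∑' k, _ * ?_ with k
        · exact expNeg_le_one _
        · refine expNeg_mul_expNeg_le ?_
          rw [mul_assoc, ← mul_add]
          gcongr
          exact hF.tsum_le_add_kernelExponent hδ (by positivity)
    _ ≤ a * d + ∫⁻ ω, palmSum F (fun i => X i ω) ∂P := by
        rw [one_mul, ← hcells]
        gcongr with ω
        exact hle ω

theorem lintegral_palmSum (hX : IsPoissonProcess P lam X) (hF : IsMonotoneKernel F) :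
    ∫⁻ ω, palmSum F (fun i => X i ω) ∂P =
      ENNReal.ofReal lam * ∫⁻ s in Ioi 0, expNeg (ENNReal.ofReal lam * kernelExponent F s) := by
  have hmesh : Tendsto ENNReal.ofReal (𝓝[>] 0) (𝓝 0) :=
    (ENNReal.continuous_ofReal.tendsto' 0 0 ENNReal.ofReal_zero).mono_left nhdsWithin_le_nhds
  have herror : Tendsto (fun δ => ENNReal.ofReal lam * ENNReal.ofReal δ) (𝓝[>] 0) (𝓝 0) := by
    simpa using ENNReal.Tendsto.const_mul hmesh (.inr ENNReal.ofReal_ne_top)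
  have hfactor (b : ℝ≥0∞) : Tendsto (fun δ =>
      expNeg (ENNReal.ofReal lam * ENNReal.ofReal δ) * b) (𝓝[>] 0) (𝓝 b) := by
    have hexp := (continuous_expNeg.tendsto 0).comp herror
    rw [expNeg_zero] at hexp
    simpa using ENNReal.Tendsto.mul_const hexp (.inl one_ne_zero)
  refine le_antisymm (le_of_tendsto_of_tendsto (hfactor _) ?_ (eventually_nhdsWithin_of_forall
    fun δ => expNeg_mul_lintegral_palmSum_le hX hF)) (le_of_tendsto_of_tendsto (hfactor _) ?_
    (eventually_nhdsWithin_of_forall fun δ => expNeg_mul_lintegral_le_lintegral_palmSum hX hF))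
  · simpa using ENNReal.Tendsto.const_mul (hmesh.add_const _) (.inr ENNReal.ofReal_ne_top)
  · simpa using herror.add_const _

end Mecke

/-! ### Rayleigh fading -/

theorem measure_prodMk_mem_of_indepFun {Ω E F : Type*} [MeasurableSpace Ω] [MeasurableSpace E]
    [MeasurableSpace F] {P : Measure Ω} [IsFiniteMeasure P] {U : Ω → E} {V : Ω → F}
    (hU : Measurable U) (hV : Measurable V) (hUV : IndepFun U V P) {A : Set (E × F)}
    (hA : MeasurableSet A) :
    P {ω | (U ω, V ω) ∈ A} = ∫⁻ ω, P {ω' | (U ω, V ω') ∈ A} ∂P := by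
  have hprod := (indepFun_iff_map_prod_eq_prod_map_map hU.aemeasurable hV.aemeasurable).1 hUV
  calc P {ω | (U ω, V ω) ∈ A} = (P.map U).prod (P.map V) A := by
        rw [← hprod, Measure.map_apply (hU.prodMk hV) hA]
        rfl
    _ = ∫⁻ ω, P.map V (Prod.mk (U ω) ⁻¹' A) ∂P := by
        rw [Measure.prod_apply hA, lintegral_map (measurable_measure_prodMk_left hA) hU]
    _ = ∫⁻ ω, P {ω' | (U ω, V ω') ∈ A} ∂P :=
        lintegral_congr fun ω => Measure.map_apply hV (measurable_prodMk_left hA)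

theorem expMeasure_lt_ofReal (s : ℝ≥0∞) : expMeasure 1 {y | s < ENNReal.ofReal y} = expNeg s := by
  have := isProbabilityMeasure_expMeasure one_pos
  induction s using ENNReal.recTopCoe with
  | top => simp [expNeg]
  | coe r =>
    have hset : {y : ℝ | (r : ℝ≥0∞) < ENNReal.ofReal y} = (Iic (r : ℝ))ᶜ := by
      ext y
      simp [ENNReal.lt_ofReal_iff_toReal_lt ENNReal.coe_ne_top]
    have hcdf := cdf_expMeasure_eq one_pos (r : ℝ)
    rw [if_pos r.coe_nonneg, cdf_eq_real, one_mul] at hcdf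
    rw [hset, ← ofReal_measureReal, probReal_compl_eq_one_sub measurableSet_Iic, hcdf,
      sub_sub_cancel, ← expNeg_ofReal r.coe_nonneg, ENNReal.ofReal_coe_nnreal]

theorem lintegral_expMeasure_expNeg {w : ℝ} (hw : 0 ≤ w) :
    ∫⁻ y, expNeg (ENNReal.ofReal y * ENNReal.ofReal w) ∂expMeasure 1 =
      ENNReal.ofReal (1 / (1 + w)) := by
  have hpdf (r : ℝ) : Measurable (exponentialPDF r) :=
    (measurable_exponentialPDFReal r).ennreal_ofReal
  have htilt (y : ℝ) : exponentialPDF 1 y * expNeg (ENNReal.ofReal y * ENNReal.ofReal w) =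
      ENNReal.ofReal (1 / (1 + w)) * exponentialPDF (1 + w) y := by
    rcases lt_or_ge y 0 with hy | hy
    · rw [exponentialPDF_of_neg hy, exponentialPDF_of_neg hy, zero_mul, mul_zero]
    · rw [exponentialPDF_of_nonneg hy, exponentialPDF_of_nonneg hy, ← ENNReal.ofReal_mul hy,
        expNeg_ofReal (by positivity), ← ENNReal.ofReal_mul (by positivity),
        ← ENNReal.ofReal_mul (by positivity), one_mul, one_mul, ← Real.exp_add, ← mul_assoc,
        one_div_mul_cancel (by positivity), one_mul]
      ring_nf
  calc ∫⁻ y, expNeg (ENNReal.ofReal y * ENNReal.ofReal w) ∂expMeasure 1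
      = ∫⁻ y, exponentialPDF 1 y * expNeg (ENNReal.ofReal y * ENNReal.ofReal w) :=
        lintegral_withDensity_eq_lintegral_mul _ (hpdf 1)
          (continuous_expNeg.measurable.comp (by fun_prop))
    _ = ENNReal.ofReal (1 / (1 + w)) := by
        simp only [htilt]
        rw [lintegral_const_mul _ (hpdf _), lintegral_exponentialPDF_eq_one (by positivity),
          mul_one]

section Fading

variable {Ω ι : Type*} [MeasurableSpace Ω] {P : Measure Ω} {g : ι → Ω → ℝ}

theorem indepFun_subtype_ne (hg : ∀ j, Measurable (g j)) (hind : iIndepFun g P) (i : ι) :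
    IndepFun (fun ω (j : {j : ι // j ≠ i}) => g j ω) (g i) P := by
  refine indep_of_indep_of_le_right (indep_of_indep_of_le_left
    (indep_iSup_of_disjoint (fun j => (hg j).comap_le) hind (disjoint_compl_left (a := {i}))) ?_)
    (le_iSup₂_of_le i rfl le_rfl)
  simp only [MeasurableSpace.pi, MeasurableSpace.comap_iSup, MeasurableSpace.comap_comp]
  exact iSup_le fun j => le_iSup₂_of_le (j : ι) j.2 le_rfl

theorem measure_lt_ofReal_of_indepFun [IsFiniteMeasure P] {S : Ω → ℝ≥0∞} {Y : Ω → ℝ}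
    (hS : Measurable S) (hY : Measurable Y) (hlaw : P.map Y = expMeasure 1)
    (hSY : IndepFun S Y P) :
    P {ω | S ω < ENNReal.ofReal (Y ω)} = ∫⁻ ω, expNeg (S ω) ∂P := by
  have htail (s : ℝ≥0∞) : P {ω | s < ENNReal.ofReal (Y ω)} = expNeg s := by
    rw [← expMeasure_lt_ofReal, ← hlaw, Measure.map_apply hY
      (measurableSet_lt measurable_const ENNReal.measurable_ofReal)]
    rfl
  simp only [← htail]
  exact measure_prodMk_mem_of_indepFun (A := {p | p.1 < ENNReal.ofReal p.2}) hS hY hSY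
    (measurableSet_lt measurable_fst measurable_snd.ennreal_ofReal)

theorem measure_tsum_lt_fading [Countable ι] (hg : ∀ j, Measurable (g j))
    (hlaw : ∀ j, P.map (g j) = expMeasure 1) (hind : iIndepFun g P) (i : ι) {w : ι → ℝ}
    (hw : ∀ j, 0 ≤ w j) :
    P {ω | ∑' j : {j : ι // j ≠ i}, ENNReal.ofReal (g j ω) * ENNReal.ofReal (w j) <
      ENNReal.ofReal (g i ω)} =
      ∏' j : {j : ι // j ≠ i}, ENNReal.ofReal (1 / (1 + w j)) := by
  have := hind.isProbabilityMeasure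
  let u (j : ι) (y : ℝ) : ℝ≥0∞ := ENNReal.ofReal y * ENNReal.ofReal (w j)
  have hu (j : ι) : Measurable (u j) := by fun_prop
  have hexp (j : ι) : Measurable fun y => expNeg (u j y) := continuous_expNeg.measurable.comp (hu j)
  have hS : Measurable fun y : {j : ι // j ≠ i} → ℝ => ∑' j : {j : ι // j ≠ i}, u j (y j) :=
    .tsum fun j => (hu j).comp (measurable_pi_apply j)
  have hmarks : Measurable fun ω (j : {j : ι // j ≠ i}) => g j ω :=
    measurable_pi_lambda _ fun j => hg j
  have hindexp : iIndepFun (fun (j : {j : ι // j ≠ i}) ω => expNeg (u j (g j ω))) P :=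
    (hind.comp (fun j y => expNeg (u j y)) hexp).precomp Subtype.val_injective
  calc P {ω | ∑' j : {j : ι // j ≠ i}, u j (g j ω) < ENNReal.ofReal (g i ω)}
      = ∫⁻ ω, expNeg (∑' j : {j : ι // j ≠ i}, u j (g j ω)) ∂P :=
        measure_lt_ofReal_of_indepFun (hS.comp hmarks) (hg i) (hlaw i)
          ((indepFun_subtype_ne hg hind i).comp hS measurable_id)
    _ = ∏' j : {j : ι // j ≠ i}, ∫⁻ ω, expNeg (u j (g j ω)) ∂P := by
        simp only [expNeg_tsum]
        exact lintegral_tprod_of_iIndepFun (fun j => (hexp j).comp (hg j))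
          (fun _ _ => expNeg_le_one _) hindexp
    _ = ∏' j : {j : ι // j ≠ i}, ENNReal.ofReal (1 / (1 + w j)) := tprod_congr fun j => by
        rw [← lintegral_expMeasure_expNeg (hw j), ← hlaw j, lintegral_map (hexp j) (hg j)]

end Fading

/-! ### The coverage kernel -/

/-- The conditional probability, given the locations, that Rayleigh faded power received from
radial coordinate `s` exceeds `θ` times the one received from radial coordinate `t`; here
`a = α / 2`, and `c = π h ^ 2` accounts for the elevation. -/
noncomputable def sirKernel (θ a c s t : ℝ) : ℝ≥0∞ :=
  ENNReal.ofReal (1 / (1 + θ * ((s + c) / (t + c)) ^ a))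

theorem isMonotoneKernel_sirKernel {θ a c : ℝ} (hθ : 0 ≤ θ) (ha : 0 ≤ a) (hc : 0 < c) :
    IsMonotoneKernel (sirKernel θ a c) where
  le_one {s t} hs ht := by
    have : 0 ≤ θ * ((s + c) / (t + c)) ^ a := by positivity
    exact ENNReal.ofReal_le_one.2 (div_le_one_of_le₀ (by linarith) (by linarith))
  antitoneOn_left {t} ht s hs s' _ hss' := by
    have : 0 ≤ (s + c) / (t + c) := by have := mem_Ici.1 hs; positivity
    simp only [sirKernel]
    gcongr
  monotoneOn_right {s} hs t ht t' ht' htt' := by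
    have : 0 < t + c := by have := mem_Ici.1 ht; positivity
    have : 0 ≤ (s + c) / (t' + c) := by have := mem_Ici.1 ht'; positivity
    unfold sirKernel
    gcongr

theorem ofReal_one_div_pathLoss_eq_sirKernel (α θ : ℝ) {h : ℝ} (hh : 0 < h) (x y : Plane) :
    ENNReal.ofReal (1 / (1 + θ * (pathLoss α h ‖y‖ / pathLoss α h ‖x‖))) =
      sirKernel θ (α / 2) (Real.pi * h ^ 2) (diskArea x) (diskArea y) := by
  rw [sirKernel, diskArea, diskArea, ← mul_add, ← mul_add, mul_div_mul_left _ _ Real.pi_ne_zero,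
    Real.div_rpow (by positivity) (by positivity), pathLoss, pathLoss,
    Real.rpow_neg (by positivity), Real.rpow_neg (by positivity), inv_div_inv]

open Classical in
/-- The kernel `F`, set to `0` off the relation `R`: the corresponding products are supported on
the configurations in which the chosen point is in relation `R` to all others. -/
noncomputable def restrictKernel (R : ℝ → ℝ → Prop) (F : ℝ → ℝ → ℝ≥0∞) (s t : ℝ) : ℝ≥0∞ :=
  if R s t then F s t else 0

section RestrictKernel

variable {R : ℝ → ℝ → Prop} {F : ℝ → ℝ → ℝ≥0∞}

theorem restrictKernel_true : restrictKernel (fun _ _ => True) F = F := by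
  ext s t
  rw [restrictKernel, if_pos trivial]

theorem IsMonotoneKernel.restrict (hF : IsMonotoneKernel F)
    (hR : ∀ {s s' t t'}, s' ≤ s → t ≤ t' → R s t → R s' t') :
    IsMonotoneKernel (restrictKernel R F) where
  le_one {s t} hs ht := by
    unfold restrictKernel
    split_ifs
    exacts [hF.le_one hs ht, zero_le_one]
  antitoneOn_left {t} ht s hs s' hs' hss' := by
    by_cases hRs : R s' t
    · simp only [restrictKernel, if_pos hRs, if_pos (hR hss' le_rfl hRs)]
      exact hF.antitoneOn_left ht hs hs' hss'
    · simp only [restrictKernel, if_neg hRs, zero_le]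
  monotoneOn_right {s} hs t ht t' ht' htt' := by
    by_cases hRt : R s t
    · simp only [restrictKernel, if_pos hRt, if_pos (hR le_rfl htt' hRt)]
      exact hF.monotoneOn_right hs ht ht' htt'
    · simp only [restrictKernel, if_neg hRt, zero_le]

theorem kernelExponent_restrictKernel {s : ℝ} (hs : 0 ≤ s) (hlt : ∀ {t}, t < s → ¬R s t)
    (hgt : ∀ {t}, s < t → R s t) :
    kernelExponent (restrictKernel R F) s =
      ENNReal.ofReal s + ∫⁻ t in Ioi s, (1 - F s t) := by
  have hnear : ∫⁻ t in Ioc 0 s, (1 - restrictKernel R F s t) = ENNReal.ofReal s := by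
    rw [← setLIntegral_congr Ioo_ae_eq_Ioc, setLIntegral_congr_fun (g := fun _ => 1)
      measurableSet_Ioo fun t ht => by simp only [restrictKernel, if_neg (hlt ht.2), tsub_zero]]
    simp
  have hfar : ∫⁻ t in Ioi s, (1 - restrictKernel R F s t) = ∫⁻ t in Ioi s, (1 - F s t) :=
    setLIntegral_congr_fun measurableSet_Ioi fun t ht => by
      simp only [restrictKernel, if_pos (hgt ht)]
  rw [kernelExponent, ← Ioc_union_Ioi_eq_Ioi hs,
    lintegral_union measurableSet_Ioi Ioc_disjoint_Ioi_same, hnear, hfar]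

open Classical in
theorem tprod_restrictKernel {ι : Type*} (u : ι → ℝ) (s : ℝ) (hle : ∀ j, F s (u j) ≤ 1) :
    ∏' j, restrictKernel R F s (u j) = if ∀ j, R s (u j) then ∏' j, F s (u j) else 0 := by
  split_ifs with hall
  · exact tprod_congr fun j => if_pos (hall j)
  · obtain ⟨j, hj⟩ := not_forall.1 hall
    refine le_antisymm ?_ zero_le
    rw [ENNReal.tprod_eq_iInf_prod fun j => ?_]
    · exact (iInf_le _ {j}).trans_eq ((Finset.prod_singleton _ _).trans (if_neg hj))
    · unfold restrictKernel
      split_ifs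
      exacts [hle j, zero_le_one]

end RestrictKernel

/-! ### Coverage as a sum over the base stations -/

section Network

variable {Ω : Type*} {α h θ : ℝ} {X : ℕ → Ω → Plane} {g : ℕ → Ω → ℝ}

theorem pathLoss_pos (hh : 0 < h) (α r : ℝ) : 0 < pathLoss α h r :=
  Real.rpow_pos_of_pos (by positivity) _

theorem lt_sir_iff (hh : 0 < h) (hθ : 0 < θ) (i : ℕ) (ω : Ω) :
    ENNReal.ofReal θ < sir α h X g i ω ↔
      ∑' j : {j : ℕ // j ≠ i}, ENNReal.ofReal (g j ω) *
        ENNReal.ofReal (θ * (pathLoss α h ‖X j ω‖ / pathLoss α h ‖X i ω‖)) <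
      ENNReal.ofReal (g i ω) := by
  have hL (j : ℕ) := pathLoss_pos hh α ‖X j ω‖
  have hθ0 : ENNReal.ofReal θ ≠ 0 := by simpa using hθ
  have hLi0 : ENNReal.ofReal (pathLoss α h ‖X i ω‖) ≠ 0 := by simpa using hL i
  rw [sir, ENNReal.lt_div_iff_mul_lt (.inr ENNReal.ofReal_ne_top) (.inr hθ0), rxPower,
    ENNReal.ofReal_mul' (hL i).le, ← ENNReal.div_lt_iff (.inl hLi0) (.inl ENNReal.ofReal_ne_top),
    interference, ← ENNReal.tsum_mul_left, div_eq_mul_inv, ← ENNReal.tsum_mul_right]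
  refine iff_of_eq (congrArg (· < _) (tsum_congr fun j => ?_))
  rw [rxPower, ENNReal.ofReal_mul' (hL j).le, ENNReal.ofReal_mul hθ.le,
    ENNReal.ofReal_div_of_pos (hL i), div_eq_mul_inv]
  ring

theorem rxPower_le_interference {i j : ℕ} (hij : j ≠ i) (ω : Ω) :
    rxPower α h X g j ω ≤ interference α h X g i ω :=
  ENNReal.le_tsum (f := fun k : {k : ℕ // k ≠ i} => rxPower α h X g k ω) ⟨j, hij⟩

theorem interference_lt_rxPower (hθ : 1 ≤ θ) {i : ℕ} {ω : Ω}
    (hi : ENNReal.ofReal θ < sir α h X g i ω) :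
    interference α h X g i ω < rxPower α h X g i ω := by
  have hone : 1 < sir α h X g i ω := (ENNReal.one_le_ofReal.2 hθ).trans_lt hi
  rwa [sir, ENNReal.lt_div_iff_mul_lt (.inr ENNReal.one_ne_top) (.inr one_ne_zero),
    one_mul] at hone

theorem eq_of_lt_sir (hθ : 1 ≤ θ) {i j : ℕ} {ω : Ω} (hi : ENNReal.ofReal θ < sir α h X g i ω)
    (hj : ENNReal.ofReal θ < sir α h X g j ω) : i = j := by
  by_contra hij
  exact lt_asymm
    ((rxPower_le_interference (Ne.symm hij) ω).trans_lt (interference_lt_rxPower hθ hi))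
    ((rxPower_le_interference hij ω).trans_lt (interference_lt_rxPower hθ hj))

variable [MeasurableSpace Ω]

theorem measurable_rxPower (hX : ∀ i, Measurable (X i)) (hg : ∀ i, Measurable (g i)) (α h : ℝ)
    (i : ℕ) : Measurable (rxPower α h X g i) := by
  have := hX i
  have := hg i
  unfold rxPower pathLoss
  fun_prop

theorem measurable_sir (hX : ∀ i, Measurable (X i)) (hg : ∀ i, Measurable (g i)) (α h : ℝ)
    (i : ℕ) : Measurable (sir α h X g i) :=
  (measurable_rxPower hX hg α h i).div (.tsum fun j => measurable_rxPower hX hg α h j)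

theorem measurableSet_lt_sir (hX : ∀ i, Measurable (X i)) (hg : ∀ i, Measurable (g i))
    (α h θ : ℝ) (i : ℕ) : MeasurableSet {ω | ENNReal.ofReal θ < sir α h X g i ω} :=
  measurableSet_lt measurable_const (measurable_sir hX hg α h i)

variable {R : ℝ → ℝ → Prop}

theorem measurableSet_forall_rel (hX : ∀ i, Measurable (X i))
    (hR : MeasurableSet {p : ℝ × ℝ | R p.1 p.2}) (i : ℕ) :
    MeasurableSet {ω | ∀ j : {j : ℕ // j ≠ i}, R (diskArea (X i ω)) (diskArea (X j ω))} := by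
  simp only [ofPred_forall]
  exact .iInter fun j => ((measurable_diskArea.comp (hX i)).prodMk
    (measurable_diskArea.comp (hX j))) hR

variable {P : Measure Ω} {lam : ℝ}

namespace IsRayleighNetwork

theorem measure_lt_sir_of_locations (hN : IsRayleighNetwork P lam X g) (hh : 0 < h) (hθ : 0 < θ)
    (x : ℕ → Plane) (i : ℕ) :
    P {ω | ENNReal.ofReal θ < sir α h (fun j _ => x j) g i ω} =
      ∏' j : {j : ℕ // j ≠ i},
        sirKernel θ (α / 2) (Real.pi * h ^ 2) (diskArea (x i)) (diskArea (x j)) := by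
  have hL (j : ℕ) := (pathLoss_pos hh α ‖x j‖).le
  simp only [lt_sir_iff hh hθ, ← ofReal_one_div_pathLoss_eq_sirKernel α θ hh]
  exact measure_tsum_lt_fading hN.fading_measurable hN.fading_law hN.fading_indep i
    fun j => mul_nonneg hθ.le (div_nonneg (hL j) (hL i))

theorem measure_rel_and_lt_sir (hN : IsRayleighNetwork P lam X g) (hα : 0 ≤ α) (hh : 0 < h)
    (hθ : 0 < θ) (hR : MeasurableSet {p : ℝ × ℝ | R p.1 p.2}) (i : ℕ) :
    P {ω | (∀ j : {j : ℕ // j ≠ i}, R (diskArea (X i ω)) (diskArea (X j ω))) ∧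
      ENNReal.ofReal θ < sir α h X g i ω} =
      ∫⁻ ω, ∏' j : {j : ℕ // j ≠ i}, restrictKernel R
        (sirKernel θ (α / 2) (Real.pi * h ^ 2)) (diskArea (X i ω)) (diskArea (X j ω)) ∂P := by
  have := hN.isProbabilityMeasure
  have hfst (j : ℕ) : Measurable fun p : (ℕ → Plane) × (ℕ → ℝ) => p.1 j := by fun_prop
  have hsnd (j : ℕ) : Measurable fun p : (ℕ → Plane) × (ℕ → ℝ) => p.2 j := by fun_prop
  have hevent := (measurableSet_forall_rel hfst hR i).inter (measurableSet_lt_sir hfst hsnd α h θ i)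
  refine (measure_prodMk_mem_of_indepFun (measurable_pi_lambda _ hN.poisson.measurable)
    (measurable_pi_lambda _ hN.fading_measurable) hN.marks_indep hevent).trans
    (lintegral_congr fun ω => ?_)
  rw [tprod_restrictKernel _ _ fun j => (isMonotoneKernel_sirKernel hθ.le (by positivity)
    (by positivity)).le_one (diskArea_nonneg _) (diskArea_nonneg _)]
  split_ifs with hrel
  · exact (congrArg P (Set.ext fun ω' => and_iff_right hrel)).trans
      (hN.measure_lt_sir_of_locations hh hθ (fun j => X j ω) i)
  · exact measure_mono_null (fun ω' hω' => hrel hω'.1) measure_empty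

theorem tsum_measure_rel_and_lt_sir (hN : IsRayleighNetwork P lam X g) (hα : 0 ≤ α) (hh : 0 < h)
    (hθ : 0 < θ) (hR : MeasurableSet {p : ℝ × ℝ | R p.1 p.2}) :
    ∑' i, P {ω | (∀ j : {j : ℕ // j ≠ i}, R (diskArea (X i ω)) (diskArea (X j ω))) ∧
      ENNReal.ofReal θ < sir α h X g i ω} =
      ∫⁻ ω, palmSum (restrictKernel R (sirKernel θ (α / 2) (Real.pi * h ^ 2)))
        (fun i => X i ω) ∂P := by
  have hdisk (j : ℕ) : Measurable fun ω => diskArea (X j ω) :=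
    measurable_diskArea.comp (hN.poisson.measurable j)
  simp only [hN.measure_rel_and_lt_sir hα hh hθ hR, palmSum]
  refine (lintegral_tsum fun i => (Measurable.tprod fun j => ?_).aemeasurable).symm
  refine Measurable.ite (((hdisk i).prodMk (hdisk j)) hR) ?_ measurable_const
  have := hdisk i
  have := hdisk j
  unfold sirKernel
  fun_prop

end IsRayleighNetwork

theorem measure_closest_le :
    P {ω | ∃ i, (∀ j, ‖X i ω‖ ≤ ‖X j ω‖) ∧ ENNReal.ofReal θ < sir α h X g i ω} ≤
      ∑' i, P {ω | (∀ j : {j : ℕ // j ≠ i}, diskArea (X i ω) ≤ diskArea (X j ω)) ∧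
        ENNReal.ofReal θ < sir α h X g i ω} := by
  refine (measure_mono ?_).trans (measure_iUnion_le _)
  rintro ω ⟨i, hclosest, hsir⟩
  exact mem_iUnion.2 ⟨i, fun j => diskArea_le_diskArea_iff.2 (hclosest j), hsir⟩

theorem measure_strongest_le :
    P {ω | ∃ i, (∀ j, sir α h X g j ω ≤ sir α h X g i ω) ∧
      ENNReal.ofReal θ < sir α h X g i ω} ≤
      ∑' i, P {ω | ENNReal.ofReal θ < sir α h X g i ω} := by
  refine (measure_mono ?_).trans (measure_iUnion_le _)
  rintro ω ⟨i, -, hsir⟩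
  exact mem_iUnion.2 ⟨i, hsir⟩

theorem tsum_measure_le_measure_closest (hX : ∀ i, Measurable (X i))
    (hg : ∀ i, Measurable (g i)) :
    ∑' i, P {ω | (∀ j : {j : ℕ // j ≠ i}, diskArea (X i ω) < diskArea (X j ω)) ∧
      ENNReal.ofReal θ < sir α h X g i ω} ≤
      P {ω | ∃ i, (∀ j, ‖X i ω‖ ≤ ‖X j ω‖) ∧ ENNReal.ofReal θ < sir α h X g i ω} := by
  have hlt : MeasurableSet {p : ℝ × ℝ | p.1 < p.2} := measurableSet_lt measurable_fst measurable_snd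
  rw [← measure_iUnion]
  · refine measure_mono fun ω hω => ?_
    obtain ⟨i, hclosest, hsir⟩ := mem_iUnion.1 hω
    refine ⟨i, fun j => ?_, hsir⟩
    rcases eq_or_ne j i with rfl | hj
    exacts [le_rfl, diskArea_le_diskArea_iff.1 (hclosest ⟨j, hj⟩).le]
  · exact fun i j hij => Set.disjoint_left.2 fun ω hi hj =>
      lt_asymm (hi.1 ⟨j, hij.symm⟩) (hj.1 ⟨i, hij⟩)
  · exact fun i => (measurableSet_forall_rel hX hlt i).inter (measurableSet_lt_sir hX hg α h θ i)

theorem tsum_measure_le_measure_strongest (hX : ∀ i, Measurable (X i))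
    (hg : ∀ i, Measurable (g i)) (hθ : 1 ≤ θ) :
    ∑' i, P {ω | ENNReal.ofReal θ < sir α h X g i ω} ≤
      P {ω | ∃ i, (∀ j, sir α h X g j ω ≤ sir α h X g i ω) ∧
        ENNReal.ofReal θ < sir α h X g i ω} := by
  rw [← measure_iUnion]
  · refine measure_mono fun ω hω => ?_
    obtain ⟨i, hsir⟩ := mem_iUnion.1 hω
    refine ⟨i, fun j => le_of_not_gt fun hij => ?_, hsir⟩
    exact absurd hij (eq_of_lt_sir hθ hsir (hsir.trans hij) ▸ lt_irrefl _)
  · exact fun i j hij => Set.disjoint_left.2 fun ω hi hj => hij (eq_of_lt_sir hθ hi hj)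
  · exact fun i => measurableSet_lt_sir hX hg α h θ i

end Network

/-! ### The exponent of the coverage kernel -/

theorem image_add_div_Ioi {u : ℝ} (hu : 0 < u) (y c : ℝ) :
    (fun t => (t + c) / u) '' Ioi y = Ioi ((y + c) / u) := by
  simp only [div_eq_inv_mul, ← image_mul_left_Ioi (inv_pos.2 hu), ← image_add_const_Ioi,
    image_image]

theorem lintegral_Ioi_comp_add_div {u : ℝ} (hu : 0 < u) (y c : ℝ) (f : ℝ → ℝ≥0∞) :
    ∫⁻ t in Ioi y, f ((t + c) / u) = ENNReal.ofReal u * ∫⁻ v in Ioi ((y + c) / u), f v := by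
  have hderiv (t : ℝ) : HasDerivWithinAt (fun t => (t + c) / u) (1 / u) (Ioi y) t :=
    (((hasDerivAt_id t).add_const c).div_const u).hasDerivWithinAt
  have hinj : InjOn (fun t => (t + c) / u) (Ioi y) := fun t _ t' _ h =>
    add_right_cancel ((div_left_inj' hu.ne').1 h)
  rw [← image_add_div_Ioi hu, lintegral_image_eq_lintegral_abs_deriv_mul measurableSet_Ioi
    (fun t _ => hderiv t) hinj, lintegral_const_mul' _ _ ENNReal.ofReal_ne_top, ← mul_assoc,
    abs_of_pos (one_div_pos.2 hu), ← ENNReal.ofReal_mul hu.le, mul_one_div_cancel hu.ne',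
    ENNReal.ofReal_one, one_mul]

/-- The complement `1 - sirKernel θ a c s t` as a function of the ratio `v = (t + c) / (s + c)`. -/
noncomputable def sirProfile (θ a v : ℝ) : ℝ := θ * (v ^ a + θ)⁻¹

/-- The integral of `sirProfile θ a` over `(y, ∞)`, which governs the exponents of the coverage
formulas. -/
noncomputable def sirProfileTail (θ a y : ℝ) : ℝ := ∫ v in Ioi y, sirProfile θ a v

section SirProfile

variable {θ a c s v y z : ℝ}

theorem sirProfile_pos (hθ : 0 < θ) (hv : 0 ≤ v) : 0 < sirProfile θ a v := by
  unfold sirProfile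
  positivity

theorem sirProfile_le_one (hθ : 0 < θ) (hv : 0 ≤ v) : sirProfile θ a v ≤ 1 := by
  have : 0 ≤ v ^ a := by positivity
  rw [sirProfile, ← div_eq_mul_inv, div_le_one (by positivity)]
  linarith

theorem measurable_sirProfile (θ a : ℝ) : Measurable (sirProfile θ a) := by
  unfold sirProfile
  fun_prop

theorem ae_sirProfile_pos (hθ : 0 < θ) (hy : 0 ≤ y) :
    ∀ᵐ v ∂volume.restrict (Ioi y), 0 < sirProfile θ a v :=
  ae_restrict_of_forall_mem measurableSet_Ioi fun _ hv => sirProfile_pos hθ (hy.trans hv.le)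

theorem integrableOn_sirProfile_Ioc (hθ : 0 < θ) (hy : 0 ≤ y) :
    IntegrableOn (sirProfile θ a) (Ioc y z) := by
  refine Measure.integrableOn_of_bounded (M := 1) (by simp)
    (measurable_sirProfile θ a).aestronglyMeasurable
    (ae_restrict_of_forall_mem measurableSet_Ioc fun v hv => ?_)
  have hv0 : 0 ≤ v := hy.trans hv.1.le
  rw [Real.norm_of_nonneg (sirProfile_pos hθ hv0).le]
  exact sirProfile_le_one hθ hv0

theorem integrableOn_sirProfile (hθ : 0 < θ) (ha : 1 < a) (hy : 0 ≤ y) :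
    IntegrableOn (sirProfile θ a) (Ioi y) := by
  have hfar : IntegrableOn (sirProfile θ a) (Ioi 1) := by
    unfold sirProfile
    simpa only [IntegrableOn, sub_neg_eq_add] using
      (integrableOn_inv_rpow_sub ha (show -θ < 1 by linarith)).const_mul θ
  exact ((integrableOn_sirProfile_Ioc hθ hy).union hfar).mono_set fun v hv =>
    (le_or_gt v 1).imp (fun h => ⟨hv, h⟩) id

theorem antitoneOn_sirProfileTail (hθ : 0 < θ) (ha : 1 < a) :
    AntitoneOn (sirProfileTail θ a) (Ici 0) := fun _ hy _ _ h =>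
  setIntegral_mono_set (integrableOn_sirProfile hθ ha hy)
    ((ae_sirProfile_pos hθ hy).mono fun _ => le_of_lt) (Ioi_subset_Ioi h).eventuallyLE

theorem sirProfileTail_zero_le_add (hθ : 0 < θ) (ha : 1 < a) (hy : 0 ≤ y) :
    sirProfileTail θ a 0 ≤ y + sirProfileTail θ a y := by
  have hnear : ∫ v in Ioc 0 y, sirProfile θ a v ≤ ∫ _ in Ioc 0 y, (1 : ℝ) :=
    setIntegral_mono_on (integrableOn_sirProfile_Ioc hθ le_rfl) (by simp) measurableSet_Ioc
      fun v hv => sirProfile_le_one hθ hv.1.le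
  have hvol : ∫ _ in Ioc 0 y, (1 : ℝ) = y := by simp [hy]
  rw [sirProfileTail, ← Ioc_union_Ioi_eq_Ioi hy, setIntegral_union Ioc_disjoint_Ioi_same
    measurableSet_Ioi (integrableOn_sirProfile_Ioc hθ le_rfl) (integrableOn_sirProfile hθ ha hy)]
  exact add_le_add_left (hnear.trans_eq hvol) _

theorem sirProfileTail_pos (hθ : 0 < θ) (ha : 1 < a) (hy : 0 ≤ y) : 0 < sirProfileTail θ a y := by
  have hsupp : Function.support (sirProfile θ a) ∩ Ioi y = Ioi y :=
    inter_eq_right.2 fun v hv => (sirProfile_pos hθ (hy.trans hv.le)).ne'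
  rw [sirProfileTail, setIntegral_pos_iff_support_of_nonneg_ae
    ((ae_sirProfile_pos hθ hy).mono fun _ => le_of_lt) (integrableOn_sirProfile hθ ha hy), hsupp,
    Real.volume_Ioi]
  exact ENNReal.zero_lt_top

theorem sirProfileTail_mul {ρ : ℝ} (hρ : 0 < ρ) (hy : 0 ≤ y) :
    sirProfileTail (θ * ρ ^ a) a (ρ * y) = ρ * sirProfileTail θ a y := by
  have hscale : ∀ v ∈ Ioi y, sirProfile (θ * ρ ^ a) a (ρ * v) = sirProfile θ a v := fun v hv => by
    have : ρ ^ a ≠ 0 := by positivity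
    rw [sirProfile, sirProfile, Real.mul_rpow hρ.le (hy.trans hv.le), mul_comm θ, ← mul_add,
      mul_inv]
    field_simp
  rw [sirProfileTail, sirProfileTail, ← setIntegral_congr_fun measurableSet_Ioi hscale,
    integral_comp_mul_left_Ioi _ _ hρ, smul_eq_mul, mul_inv_cancel_left₀ hρ.ne']

theorem eta_one_eq_sirProfileTail {α r : ℝ} (hα : 2 < α) (hs : 0 ≤ s / r ^ α) :
    eta α s 1 r = 1 + sirProfileTail (s / r ^ α) (α / 2) 1 :=
  eta_one_eq hα hs

theorem one_sub_sirKernel {t : ℝ} (hθ : 0 < θ) (hs : 0 < s + c) (ht : 0 < t + c) :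
    1 - sirKernel θ a c s t = ENNReal.ofReal (sirProfile θ a ((t + c) / (s + c))) := by
  have : 0 < ((t + c) / (s + c)) ^ a := by positivity
  rw [sirKernel, sirProfile, ← inv_div (t + c), Real.inv_rpow (by positivity),
    ← ENNReal.ofReal_one, ← ENNReal.ofReal_sub _ (by positivity)]
  congr 1
  field_simp
  ring

theorem lintegral_one_sub_sirKernel (hθ : 0 < θ) (ha : 1 < a) (hc : 0 < c) (hs : 0 ≤ s)
    (hy : 0 ≤ y) :
    ∫⁻ t in Ioi y, (1 - sirKernel θ a c s t) =
      ENNReal.ofReal ((s + c) * sirProfileTail θ a ((y + c) / (s + c))) := by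
  have hsc : 0 < s + c := by positivity
  have hyc : 0 ≤ (y + c) / (s + c) := by positivity
  have hprofile : ∀ t ∈ Ioi y, 1 - sirKernel θ a c s t =
      ENNReal.ofReal (sirProfile θ a ((t + c) / (s + c))) := fun t ht =>
    one_sub_sirKernel hθ hsc (add_pos (hy.trans_lt ht) hc)
  rw [setLIntegral_congr_fun measurableSet_Ioi hprofile,
    lintegral_Ioi_comp_add_div hsc y c fun v => ENNReal.ofReal (sirProfile θ a v),
    ← ofReal_integral_eq_lintegral_ofReal (integrableOn_sirProfile hθ ha hyc)
      ((ae_sirProfile_pos hθ hyc).mono fun _ => le_of_lt), ← ENNReal.ofReal_mul hsc.le]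
  rfl

theorem kernelExponent_sirKernel (hθ : 0 < θ) (ha : 1 < a) (hc : 0 < c) (hs : 0 ≤ s) :
    kernelExponent (sirKernel θ a c) s =
      ENNReal.ofReal ((s + c) * sirProfileTail θ a (c / (s + c))) := by
  rw [kernelExponent, lintegral_one_sub_sirKernel hθ ha hc hs le_rfl, zero_add]

theorem kernelExponent_restrict_sirKernel {R : ℝ → ℝ → Prop} (hθ : 0 < θ) (ha : 1 < a)
    (hc : 0 < c) (hs : 0 ≤ s) (hlt : ∀ {t}, t < s → ¬R s t) (hgt : ∀ {t}, s < t → R s t) :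
    kernelExponent (restrictKernel R (sirKernel θ a c)) s =
      ENNReal.ofReal (c * sirProfileTail θ a 1 + (1 + sirProfileTail θ a 1) * s) := by
  have := sirProfileTail_pos hθ ha zero_le_one
  rw [kernelExponent_restrictKernel hs hlt hgt, lintegral_one_sub_sirKernel hθ ha hc hs hs,
    div_self (by positivity), ← ENNReal.ofReal_add hs (by positivity)]
  congr 1
  ring

theorem kernelExponent_sirKernel_le (hθ : 0 < θ) (ha : 1 < a) (hc : 0 < c) (hs : 0 ≤ s) :
    kernelExponent (sirKernel θ a c) s ≤
      ENNReal.ofReal (c * sirProfileTail θ a 0 + sirProfileTail θ a 0 * s) := by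
  have hratio : 0 ≤ c / (s + c) := by positivity
  rw [kernelExponent_sirKernel hθ ha hc hs, mul_comm _ s, ← add_mul, add_comm c]
  gcongr
  exact antitoneOn_sirProfileTail hθ ha self_mem_Ici hratio hratio

theorem ofReal_le_kernelExponent_sirKernel_add (hθ : 0 < θ) (ha : 1 < a) (hc : 0 < c)
    (hs : 0 ≤ s) :
    ENNReal.ofReal (c * sirProfileTail θ a 0 + sirProfileTail θ a 0 * s) ≤
      kernelExponent (sirKernel θ a c) s + ENNReal.ofReal c := by
  have hratio : 0 ≤ c / (s + c) := by positivity
  have := sirProfileTail_pos hθ ha hratio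
  rw [kernelExponent_sirKernel hθ ha hc hs, ← ENNReal.ofReal_add (by positivity) hc.le]
  refine ENNReal.ofReal_le_ofReal ?_
  calc c * sirProfileTail θ a 0 + sirProfileTail θ a 0 * s
      = (s + c) * sirProfileTail θ a 0 := by ring
    _ ≤ (s + c) * (c / (s + c) + sirProfileTail θ a (c / (s + c))) := by
        gcongr
        exact sirProfileTail_zero_le_add hθ ha hratio
    _ = (s + c) * sirProfileTail θ a (c / (s + c)) + c := by
        field_simp
        ring

theorem ofReal_le_kernelExponent_sirKernel (hθ : 0 < θ) (ha : 1 < a) (hc : 0 < c) (hs : 0 ≤ s) :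
    ENNReal.ofReal (c * sirProfileTail θ a 1 + sirProfileTail θ a 1 * s) ≤
      kernelExponent (sirKernel θ a c) s := by
  have hratio : 0 ≤ c / (s + c) := by positivity
  have hle_one : c / (s + c) ≤ 1 := div_le_one_of_le₀ (by linarith) (by positivity)
  rw [kernelExponent_sirKernel hθ ha hc hs, mul_comm _ s, ← add_mul, add_comm c]
  gcongr
  exact antitoneOn_sirProfileTail hθ ha hratio (mem_Ici.2 zero_le_one) hle_one

end SirProfile

/-! ### Exponential integrals -/

theorem lintegral_Ioi_exp_neg_mul {r : ℝ} (hr : 0 < r) :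
    ∫⁻ x in Ioi (0 : ℝ), ENNReal.ofReal (Real.exp (-r * x)) = ENNReal.ofReal (1 / r) := by
  rw [← ofReal_integral_eq_lintegral_ofReal (integrableOn_exp_mul_Ioi (neg_lt_zero.2 hr) 0)
    (ae_of_all _ fun _ => (Real.exp_pos _).le), integral_exp_mul_Ioi (neg_lt_zero.2 hr), mul_zero,
    Real.exp_zero, neg_div_neg_eq]

theorem lintegral_Ioi_exp_neg_mul_rpow {p b : ℝ} (hp : 0 < p) (hb : 0 < b) :
    ∫⁻ v in Ioi (0 : ℝ), ENNReal.ofReal (Real.exp (-b * v ^ p)) =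
      ENNReal.ofReal (b ^ (-1 / p) * Real.Gamma (1 / p + 1)) := by
  have hint : IntegrableOn (fun v : ℝ => Real.exp (-b * v ^ p)) (Ioi 0) := by
    simpa only [Real.rpow_zero, one_mul] using
      integrableOn_rpow_mul_exp_neg_mul_rpow neg_one_lt_zero hp hb
  rw [← ofReal_integral_eq_lintegral_ofReal hint (ae_of_all _ fun _ => (Real.exp_pos _).le),
    integral_exp_neg_mul_rpow hp hb]

theorem lintegral_Ioi_exp_neg_mul_rpow_sub_one {s : ℝ} (hs : 0 < s) :
    ∫⁻ x in Ioi (0 : ℝ), ENNReal.ofReal (Real.exp (-x) * x ^ (s - 1)) =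
      ENNReal.ofReal (Real.Gamma s) := by
  rw [Real.Gamma_eq_integral hs, ofReal_integral_eq_lintegral_ofReal
    (Real.GammaIntegral_convergent hs) (ae_restrict_of_forall_mem measurableSet_Ioi fun x hx => ?_)]
  have := mem_Ioi.1 hx
  positivity

theorem lintegral_Ioi_inv_rpow_add_one {a : ℝ} (ha : 1 < a) :
    ∫⁻ v in Ioi (0 : ℝ), ENNReal.ofReal (1 / (v ^ a + 1)) =
      ENNReal.ofReal (Real.Gamma (1 / a + 1) * Real.Gamma (1 - 1 / a)) := by
  have ha0 : 0 < a := one_pos.trans ha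
  have hlaplace : ∀ v ∈ Ioi (0 : ℝ), ENNReal.ofReal (1 / (v ^ a + 1)) =
      ∫⁻ x in Ioi (0 : ℝ), ENNReal.ofReal (Real.exp (-x) * Real.exp (-x * v ^ a)) := by
    intro v hv
    have := mem_Ioi.1 hv
    rw [← lintegral_Ioi_exp_neg_mul (by positivity)]
    simp only [← Real.exp_add]
    congr! 4
    ring
  have hinner : ∀ x ∈ Ioi (0 : ℝ),
      ∫⁻ v in Ioi (0 : ℝ), ENNReal.ofReal (Real.exp (-x) * Real.exp (-x * v ^ a)) =
        ENNReal.ofReal (Real.Gamma (1 / a + 1)) *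
          ENNReal.ofReal (Real.exp (-x) * x ^ ((1 - 1 / a) - 1)) := by
    intro x hx
    have := mem_Ioi.1 hx
    have : 0 < Real.Gamma (1 / a + 1) := Real.Gamma_pos_of_pos (by positivity)
    simp only [ENNReal.ofReal_mul (Real.exp_pos (-x)).le]
    rw [lintegral_const_mul' _ _ ENNReal.ofReal_ne_top, lintegral_Ioi_exp_neg_mul_rpow ha0 hx,
      sub_sub_cancel_left, ← neg_div, ENNReal.ofReal_mul (by positivity)]
    ring
  rw [setLIntegral_congr_fun measurableSet_Ioi hlaplace,
    lintegral_lintegral_swap (by fun_prop),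
    setLIntegral_congr_fun measurableSet_Ioi hinner,
    lintegral_const_mul' _ _ ENNReal.ofReal_ne_top,
    lintegral_Ioi_exp_neg_mul_rpow_sub_one (sub_pos.2 ((div_lt_one ha0).2 ha)),
    ENNReal.ofReal_mul (Real.Gamma_pos_of_pos (by positivity)).le]

theorem sirProfileTail_zero_eq {θ a : ℝ} (hθ : 0 < θ) (ha : 1 < a) :
    sirProfileTail θ a 0 = θ ^ (1 / a) * (Real.Gamma (1 / a + 1) * Real.Gamma (1 - 1 / a)) := by
  have ha0 : 0 < a := one_pos.trans ha
  have hscale := sirProfileTail_mul (θ := 1) (a := a) (Real.rpow_pos_of_pos hθ (1 / a)) le_rfl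
  have : 0 < Real.Gamma (1 / a + 1) := Real.Gamma_pos_of_pos (by positivity)
  have : 0 < Real.Gamma (1 - 1 / a) := Real.Gamma_pos_of_pos (sub_pos.2 ((div_lt_one ha0).2 ha))
  rw [one_mul, mul_zero, one_div, Real.rpow_inv_rpow hθ.le ha0.ne', ← one_div] at hscale
  rw [hscale, sirProfileTail, integral_eq_lintegral_of_nonneg_ae
    ((ae_sirProfile_pos one_pos le_rfl).mono fun _ => le_of_lt)
    (measurable_sirProfile 1 a).aestronglyMeasurable]
  simp only [sirProfile, one_mul, ← one_div (_ + _)]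
  rw [lintegral_Ioi_inv_rpow_add_one ha, ENNReal.toReal_ofReal (by positivity)]

theorem covNlosStrongest_eq {α θ : ℝ} (hα : 2 < α) (hθ : 0 < θ) :
    covNlosStrongest α θ = 1 / sirProfileTail θ (α / 2) 0 := by
  have : 0 < α := by linarith
  have hne : -(2 / α) ≠ 0 := neg_ne_zero.2 (by positivity)
  have hgamma : Real.Gamma (1 - 2 / α) = -(2 / α) * Real.Gamma (-(2 / α)) := by
    rw [sub_eq_neg_add, Real.Gamma_add_one hne]
  rw [covNlosStrongest, sirProfileTail_zero_eq hθ (by linarith), one_div_div, hgamma, zetaFading,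
    Real.Gamma_one, add_comm (2 / α)]
  congr 1
  ring

/-! ### The coverage formulas -/

theorem mul_lintegral_expNeg_affine {lam κ b : ℝ} (hlam : 0 < lam) (hκ : 0 < κ) (hb : 0 ≤ b) :
    ENNReal.ofReal lam *
      ∫⁻ s in Ioi 0, expNeg (ENNReal.ofReal lam * ENNReal.ofReal (b + κ * s)) =
      ENNReal.ofReal (Real.exp (-(lam * b)) / κ) := by
  have hsplit : ∀ s ∈ Ioi (0 : ℝ), expNeg (ENNReal.ofReal lam * ENNReal.ofReal (b + κ * s)) =
      ENNReal.ofReal (Real.exp (-(lam * b))) * ENNReal.ofReal (Real.exp (-(lam * κ) * s)) := by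
    intro s hs
    have := mem_Ioi.1 hs
    rw [← ENNReal.ofReal_mul hlam.le, expNeg_ofReal (by positivity),
      ← ENNReal.ofReal_mul (Real.exp_pos _).le, ← Real.exp_add]
    congr 2
    ring
  rw [setLIntegral_congr_fun measurableSet_Ioi hsplit,
    lintegral_const_mul' _ _ ENNReal.ofReal_ne_top, lintegral_Ioi_exp_neg_mul (mul_pos hlam hκ),
    ← ENNReal.ofReal_mul (Real.exp_pos _).le, ← ENNReal.ofReal_mul hlam.le]
  congr 1
  field_simp

/-- The expected number of base stations whose signal-to-interference ratio exceeds `θ` in a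
network of density `lam`; here `a = α / 2`, and `c = π h ^ 2` accounts for the elevation. -/
noncomputable def meanCoverage (θ a c lam : ℝ) : ℝ≥0∞ :=
  ENNReal.ofReal lam *
    ∫⁻ s in Ioi 0, expNeg (ENNReal.ofReal lam * kernelExponent (sirKernel θ a c) s)

section MeanCoverage

variable {θ a c lam : ℝ}

theorem meanCoverage_le (hθ : 0 < θ) (ha : 1 < a) (hc : 0 < c) (hlam : 0 < lam) :
    meanCoverage θ a c lam ≤ ENNReal.ofReal
      (Real.exp (-(lam * (c * sirProfileTail θ a 1))) / sirProfileTail θ a 1) := by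
  have hT := sirProfileTail_pos hθ ha zero_le_one
  rw [meanCoverage, ← mul_lintegral_expNeg_affine hlam hT (by positivity)]
  gcongr ENNReal.ofReal lam * ?_
  exact setLIntegral_mono' measurableSet_Ioi fun s hs => antitone_expNeg <| by
    gcongr
    exact ofReal_le_kernelExponent_sirKernel hθ ha hc hs.le

theorem le_meanCoverage (hθ : 0 < θ) (ha : 1 < a) (hc : 0 < c) (hlam : 0 < lam) :
    ENNReal.ofReal (Real.exp (-(lam * (c * sirProfileTail θ a 0))) / sirProfileTail θ a 0) ≤
      meanCoverage θ a c lam := by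
  have hT := sirProfileTail_pos hθ ha le_rfl
  rw [meanCoverage, ← mul_lintegral_expNeg_affine hlam hT (by positivity)]
  gcongr ENNReal.ofReal lam * ?_
  exact setLIntegral_mono' measurableSet_Ioi fun s hs => antitone_expNeg <| by
    gcongr
    exact kernelExponent_sirKernel_le hθ ha hc hs.le

theorem meanCoverage_mul_expNeg_le (hθ : 0 < θ) (ha : 1 < a) (hc : 0 < c) (hlam : 0 < lam) :
    meanCoverage θ a c lam * expNeg (ENNReal.ofReal lam * ENNReal.ofReal c) ≤ ENNReal.ofReal
      (Real.exp (-(lam * (c * sirProfileTail θ a 0))) / sirProfileTail θ a 0) := by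
  have hT := sirProfileTail_pos hθ ha le_rfl
  have hfin : expNeg (ENNReal.ofReal lam * ENNReal.ofReal c) ≠ ∞ :=
    ((expNeg_le_one _).trans_lt ENNReal.one_lt_top).ne
  rw [meanCoverage, ← mul_lintegral_expNeg_affine hlam hT (by positivity), mul_assoc,
    ← lintegral_mul_const' _ _ hfin]
  gcongr ENNReal.ofReal lam * ?_
  refine setLIntegral_mono' measurableSet_Ioi fun s hs => expNeg_mul_expNeg_le ?_
  rw [← mul_add]
  gcongr
  exact ofReal_le_kernelExponent_sirKernel_add hθ ha hc hs.le

theorem meanCoverage_ne_top (hθ : 0 < θ) (ha : 1 < a) (hc : 0 < c) (hlam : 0 < lam) :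
    meanCoverage θ a c lam ≠ ∞ :=
  ((meanCoverage_le hθ ha hc hlam).trans_lt ENNReal.ofReal_lt_top).ne

theorem tendsto_meanCoverage_zero (hθ : 0 < θ) (ha : 1 < a) (hc : 0 < c) :
    Tendsto (meanCoverage θ a c) (𝓝[>] 0) (𝓝 (ENNReal.ofReal (1 / sirProfileTail θ a 0))) := by
  have hlim {f : ℝ → ℝ} (hf : Continuous f) (hf0 : f 0 = 1 / sirProfileTail θ a 0) :
      Tendsto (fun lam => ENNReal.ofReal (f lam)) (𝓝[>] 0)
        (𝓝 (ENNReal.ofReal (1 / sirProfileTail θ a 0))) :=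
    hf0 ▸ (ENNReal.tendsto_ofReal (hf.tendsto 0)).mono_left nhdsWithin_le_nhds
  refine tendsto_of_tendsto_of_tendsto_of_le_of_le'
    (hlim (f := fun lam => Real.exp (-(lam * (c * sirProfileTail θ a 0))) / sirProfileTail θ a 0)
      (by fun_prop) (by simp))
    (hlim (f := fun lam => Real.exp (-(lam * (c * sirProfileTail θ a 0))) / sirProfileTail θ a 0 /
      Real.exp (-(lam * c))) (by fun_prop (disch := simp)) (by simp))
    (eventually_nhdsWithin_of_forall fun lam hlam => le_meanCoverage hθ ha hc hlam)
    (eventually_nhdsWithin_of_forall fun lam (hlam : 0 < lam) => ?_)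
  rw [ENNReal.ofReal_div_of_pos (Real.exp_pos _), ENNReal.le_div_iff_mul_le
    (.inl (ENNReal.ofReal_pos.2 (Real.exp_pos _)).ne') (.inl ENNReal.ofReal_ne_top),
    ← expNeg_ofReal (by positivity), ENNReal.ofReal_mul hlam.le]
  exact meanCoverage_mul_expNeg_le hθ ha hc hlam

theorem tendsto_exp_neg_mul_atTop {r : ℝ} (hr : 0 < r) :
    Tendsto (fun lam => Real.exp (-(lam * r))) atTop (𝓝 0) :=
  Real.tendsto_exp_neg_atTop_nhds_zero.comp (tendsto_id.atTop_mul_const hr)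

theorem tendsto_meanCoverage_atTop (hθ : 0 < θ) (ha : 1 < a) (hc : 0 < c) :
    Tendsto (meanCoverage θ a c) atTop (𝓝 0) := by
  have hT := sirProfileTail_pos hθ ha zero_le_one
  have hbound := ENNReal.tendsto_ofReal
    ((tendsto_exp_neg_mul_atTop (mul_pos hc hT)).div_const (sirProfileTail θ a 1))
  rw [zero_div, ENNReal.ofReal_zero] at hbound
  exact tendsto_of_tendsto_of_tendsto_of_le_of_le' tendsto_const_nhds hbound
    (.of_forall fun _ => zero_le)
    ((eventually_gt_atTop 0).mono fun lam hlam => meanCoverage_le hθ ha hc hlam)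

theorem aemeasurable_expNeg_kernelExponent_sirKernel (hθ : 0 ≤ θ) (ha : 0 ≤ a) (hc : 0 < c)
    (lam : ℝ) : AEMeasurable
      (fun s => expNeg (ENNReal.ofReal lam * kernelExponent (sirKernel θ a c) s))
      (volume.restrict (Ioi 0)) :=
  aemeasurable_restrict_of_antitoneOn measurableSet_Ioi
    (((isMonotoneKernel_sirKernel hθ ha hc).antitoneOn_expNeg_kernelExponent _).mono
      Ioi_subset_Ici_self)

theorem integrableOn_toReal_expNeg_kernelExponent (hθ : 0 < θ) (ha : 1 < a) (hc : 0 < c)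
    (hlam : 0 < lam) : IntegrableOn (fun s =>
      (expNeg (ENNReal.ofReal lam * kernelExponent (sirKernel θ a c) s)).toReal) (Ioi 0) := by
  have hlam0 : ENNReal.ofReal lam ≠ 0 := by simpa using hlam
  exact integrable_toReal_of_lintegral_ne_top
    (aemeasurable_expNeg_kernelExponent_sirKernel hθ.le (one_pos.trans ha).le hc lam)
    (ENNReal.lt_top_of_mul_ne_top_right (meanCoverage_ne_top hθ ha hc hlam) hlam0).ne

theorem toReal_meanCoverage (hθ : 0 ≤ θ) (ha : 0 ≤ a) (hc : 0 < c) (hlam : 0 ≤ lam) :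
    (meanCoverage θ a c lam).toReal = lam * ∫ s in Ioi 0,
      (expNeg (ENNReal.ofReal lam * kernelExponent (sirKernel θ a c) s)).toReal := by
  rw [meanCoverage, ENNReal.toReal_mul, ENNReal.toReal_ofReal hlam, integral_toReal
    (aemeasurable_expNeg_kernelExponent_sirKernel hθ ha hc lam)
    (ae_of_all _ fun s => (expNeg_le_one _).trans_lt ENNReal.one_lt_top)]

end MeanCoverage

section CoverageFormula

variable {α h θ lam r : ℝ}

theorem covFormulaClosest_eq (hα : 2 < α) (hθ : 0 ≤ θ) :
    covFormulaClosest α h θ lam =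
      Real.exp (-(lam * (Real.pi * h ^ 2 * sirProfileTail θ (α / 2) 1))) /
        (1 + sirProfileTail θ (α / 2) 1) := by
  rw [covFormulaClosest, covNlosClosest, eta_one_eq_sirProfileTail hα (by simpa using hθ),
    Real.one_rpow, div_one, add_sub_cancel_left, one_div_mul_eq_div]
  congr 3
  ring

theorem tendsto_covFormulaClosest_zero (α h θ : ℝ) :
    Tendsto (covFormulaClosest α h θ) (𝓝[>] 0) (𝓝 (covNlosClosest α θ)) := by
  have hcont : Continuous (covFormulaClosest α h θ) := by
    unfold covFormulaClosest
    fun_prop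
  exact (hcont.tendsto' 0 _ (by simp [covFormulaClosest])).mono_left nhdsWithin_le_nhds

theorem tendsto_covFormulaClosest_atTop (hα : 2 < α) (hh : 0 < h) (hθ : 0 < θ) :
    Tendsto (covFormulaClosest α h θ) atTop (𝓝 0) := by
  have := sirProfileTail_pos hθ (show 1 < α / 2 by linarith) zero_le_one
  simpa only [zero_div, ← covFormulaClosest_eq hα hθ.le] using
    (tendsto_exp_neg_mul_atTop (show 0 < Real.pi * h ^ 2 * sirProfileTail θ (α / 2) 1 by
      positivity)).div_const (1 + sirProfileTail θ (α / 2) 1)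

theorem image_pi_mul_sq_sub_Ioi (hh : 0 ≤ h) :
    (fun r => Real.pi * r ^ 2 - Real.pi * h ^ 2) '' Ioi h = Ioi 0 := by
  ext s
  constructor
  · rintro ⟨r, hr, rfl⟩
    have hr : h < r := hr
    exact sub_pos.2 (show Real.pi * h ^ 2 < Real.pi * r ^ 2 by gcongr)
  · intro hs
    have : 0 < s := hs
    have hsqrt : h ^ 2 < h ^ 2 + s / Real.pi := lt_add_of_pos_right _ (by positivity)
    refine ⟨√(h ^ 2 + s / Real.pi), Real.lt_sqrt_of_sq_lt hsqrt, ?_⟩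
    simp only [Real.sq_sqrt (show 0 ≤ h ^ 2 + s / Real.pi by positivity)]
    field_simp
    ring

theorem injOn_pi_mul_sq_sub (hh : 0 ≤ h) :
    InjOn (fun r => Real.pi * r ^ 2 - Real.pi * h ^ 2) (Ioi h) := fun _ hx _ hy hxy =>
  (pow_left_inj₀ (hh.trans hx.le) (hh.trans hy.le) two_ne_zero).1
    (mul_left_cancel₀ Real.pi_ne_zero (sub_left_injective hxy))

theorem hasDerivWithinAt_pi_mul_sq_sub (h r : ℝ) (s : Set ℝ) :
    HasDerivWithinAt (fun r => Real.pi * r ^ 2 - Real.pi * h ^ 2) (2 * Real.pi * r) s r := by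
  refine ((((hasDerivAt_pow 2 r).const_mul Real.pi).sub_const
    (Real.pi * h ^ 2)).hasDerivWithinAt).congr_deriv ?_
  push_cast
  ring

theorem covIntegrandStrongest_eq (hα : 2 < α) (hh : 0 < h) (hθ : 0 < θ) (hlam : 0 ≤ lam)
    (hr : h < r) :
    covIntegrandStrongest α h θ lam r = (expNeg (ENNReal.ofReal lam *
      kernelExponent (sirKernel θ (α / 2) (Real.pi * h ^ 2))
        (Real.pi * r ^ 2 - Real.pi * h ^ 2))).toReal * r := by
  have hr0 : 0 < r := hh.trans hr
  have hs : 0 ≤ Real.pi * r ^ 2 - Real.pi * h ^ 2 := sub_nonneg.2 (by gcongr)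
  have hρ : 0 < (r / h) ^ 2 := by positivity
  have ha : 1 < α / 2 := by linarith
  have hratio : Real.pi * h ^ 2 / (Real.pi * r ^ 2) = ((r / h) ^ 2)⁻¹ := by field_simp
  have := sirProfileTail_pos hθ ha (inv_pos.2 hρ).le
  have hthreshold : θ * r ^ α / h ^ α = θ * ((r / h) ^ 2) ^ (α / 2) := by
    rw [← Real.rpow_natCast, ← Real.rpow_mul (by positivity), Nat.cast_ofNat,
      mul_div_cancel₀ _ two_ne_zero, Real.div_rpow hr0.le hh.le, mul_div_assoc]
  have heta : eta α (θ * r ^ α) 1 h - 1 =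
      (r / h) ^ 2 * sirProfileTail θ (α / 2) ((r / h) ^ 2)⁻¹ := by
    rw [eta_one_eq_sirProfileTail hα (by positivity), hthreshold, add_sub_cancel_left,
      ← sirProfileTail_mul hρ (by positivity), mul_inv_cancel₀ hρ.ne']
  rw [covIntegrandStrongest, heta, kernelExponent_sirKernel hθ ha (by positivity) hs,
    sub_add_cancel, hratio, ← ENNReal.ofReal_mul hlam, expNeg_ofReal (by positivity),
    ENNReal.toReal_ofReal (Real.exp_pos _).le]
  congr 3
  field_simp

theorem abs_deriv_smul_eq_covIntegrandStrongest (hα : 2 < α) (hh : 0 < h) (hθ : 0 < θ)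
    (hlam : 0 ≤ lam) (hr : r ∈ Ioi h) :
    |2 * Real.pi * r| • (expNeg (ENNReal.ofReal lam *
      kernelExponent (sirKernel θ (α / 2) (Real.pi * h ^ 2))
        (Real.pi * r ^ 2 - Real.pi * h ^ 2))).toReal =
      2 * Real.pi * covIntegrandStrongest α h θ lam r := by
  have : 0 < r := hh.trans hr
  rw [covIntegrandStrongest_eq hα hh hθ hlam hr, abs_of_pos (by positivity), smul_eq_mul]
  ring

theorem integrableOn_covIntegrandStrongest (hα : 2 < α) (hh : 0 < h) (hθ : 0 < θ)
    (hlam : 0 < lam) : IntegrableOn (covIntegrandStrongest α h θ lam) (Ioi h) := by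
  have hint := integrableOn_toReal_expNeg_kernelExponent hθ (show 1 < α / 2 by linarith)
    (show 0 < Real.pi * h ^ 2 by positivity) hlam
  rw [← image_pi_mul_sq_sub_Ioi hh.le, integrableOn_image_iff_integrableOn_abs_deriv_smul
    measurableSet_Ioi (fun r _ => hasDerivWithinAt_pi_mul_sq_sub h r _)
    (injOn_pi_mul_sq_sub hh.le), integrableOn_congr_fun
    (fun r => abs_deriv_smul_eq_covIntegrandStrongest hα hh hθ hlam.le) measurableSet_Ioi] at hint
  exact (integrable_const_mul_iff (by simp [Real.pi_ne_zero]) _).1 hint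

theorem covFormulaStrongest_eq (hα : 2 < α) (hh : 0 < h) (hθ : 0 < θ) (hlam : 0 ≤ lam) :
    covFormulaStrongest α h θ lam =
      (meanCoverage θ (α / 2) (Real.pi * h ^ 2) lam).toReal := by
  rw [toReal_meanCoverage hθ.le (by linarith) (by positivity) hlam,
    ← image_pi_mul_sq_sub_Ioi hh.le, integral_image_eq_integral_abs_deriv_smul
    measurableSet_Ioi (fun r _ => hasDerivWithinAt_pi_mul_sq_sub h r _)
    (injOn_pi_mul_sq_sub hh.le), setIntegral_congr_fun measurableSet_Ioi
    fun r => abs_deriv_smul_eq_covIntegrandStrongest hα hh hθ hlam, integral_const_mul,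
    covFormulaStrongest]
  ring

theorem tendsto_covFormulaStrongest_zero (hα : 2 < α) (hh : 0 < h) (hθ : 0 < θ) :
    Tendsto (covFormulaStrongest α h θ) (𝓝[>] 0) (𝓝 (covNlosStrongest α θ)) := by
  have ha : 1 < α / 2 := by linarith
  have := sirProfileTail_pos hθ ha le_rfl
  have hlim := (ENNReal.tendsto_toReal ENNReal.ofReal_ne_top).comp
    (tendsto_meanCoverage_zero hθ ha (show 0 < Real.pi * h ^ 2 by positivity))
  rw [ENNReal.toReal_ofReal (by positivity), ← covNlosStrongest_eq hα hθ] at hlim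
  exact hlim.congr' (eventually_nhdsWithin_of_forall fun lam hlam =>
    (covFormulaStrongest_eq hα hh hθ (le_of_lt hlam)).symm)

theorem tendsto_covFormulaStrongest_atTop (hα : 2 < α) (hh : 0 < h) (hθ : 0 < θ) :
    Tendsto (covFormulaStrongest α h θ) atTop (𝓝 0) := by
  have hlim := (ENNReal.tendsto_toReal ENNReal.zero_ne_top).comp
    (tendsto_meanCoverage_atTop hθ (show 1 < α / 2 by linarith)
      (show 0 < Real.pi * h ^ 2 by positivity))
  exact hlim.congr' ((eventually_ge_atTop 0).mono fun lam hlam =>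
    (covFormulaStrongest_eq hα hh hθ hlam).symm)

/-! ### The coverage probabilities -/

variable {Ω : Type*} [MeasurableSpace Ω] {P : Measure Ω} {X : ℕ → Ω → Plane} {g : ℕ → Ω → ℝ}

namespace IsRayleighNetwork

theorem tsum_measure_closer_and_lt_sir (hN : IsRayleighNetwork P lam X g) (hα : 2 < α)
    (hh : 0 < h) (hθ : 0 < θ) (hlam : 0 < lam) {R : ℝ → ℝ → Prop}
    (hmeas : MeasurableSet {p : ℝ × ℝ | R p.1 p.2})
    (hmono : ∀ {s s' t t'}, s' ≤ s → t ≤ t' → R s t → R s' t')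
    (hlt : ∀ {s t}, t < s → ¬R s t) (hgt : ∀ {s t}, s < t → R s t) :
    ∑' i, P {ω | (∀ j : {j : ℕ // j ≠ i}, R (diskArea (X i ω)) (diskArea (X j ω))) ∧
      ENNReal.ofReal θ < sir α h X g i ω} = ENNReal.ofReal (covFormulaClosest α h θ lam) := by
  have ha : 1 < α / 2 := by linarith
  have hc : 0 < Real.pi * h ^ 2 := by positivity
  have := sirProfileTail_pos hθ ha zero_le_one
  have hkernel := (isMonotoneKernel_sirKernel hθ.le (one_pos.trans ha).le hc).restrict hmono
  rw [hN.tsum_measure_rel_and_lt_sir (by linarith) hh hθ hmeas,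
    lintegral_palmSum hN.poisson hkernel, setLIntegral_congr_fun measurableSet_Ioi fun s hs => by
      rw [kernelExponent_restrict_sirKernel hθ ha hc hs.le hlt hgt],
    mul_lintegral_expNeg_affine hlam (by positivity) (by positivity),
    covFormulaClosest_eq hα hθ.le]

theorem covProbClosest_eq (hN : IsRayleighNetwork P lam X g) (hα : 2 < α) (hh : 0 < h)
    (hθ : 0 < θ) (hlam : 0 < lam) :
    covProbClosest α h X g P θ = covFormulaClosest α h θ lam := by
  have hupper := measure_closest_le.trans_eq (hN.tsum_measure_closer_and_lt_sir hα hh hθ hlam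
    (R := (· ≤ ·)) (measurableSet_le measurable_fst measurable_snd)
    (fun hs ht h => hs.trans (h.trans ht)) not_le_of_gt le_of_lt)
  have hlower := (hN.tsum_measure_closer_and_lt_sir hα hh hθ hlam
    (R := (· < ·)) (measurableSet_lt measurable_fst measurable_snd)
    (fun hs ht h => hs.trans_lt (h.trans_le ht)) lt_asymm id).symm.trans_le
    (tsum_measure_le_measure_closest hN.poisson.measurable hN.fading_measurable)
  have := sirProfileTail_pos hθ (show 1 < α / 2 by linarith) zero_le_one
  rw [covProbClosest, measureReal_def, hupper.antisymm hlower, covFormulaClosest_eq hα hθ.le,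
    ENNReal.toReal_ofReal (by positivity)]

theorem tsum_measure_lt_sir (hN : IsRayleighNetwork P lam X g) (hα : 0 ≤ α) (hh : 0 < h)
    (hθ : 0 < θ) :
    ∑' i, P {ω | ENNReal.ofReal θ < sir α h X g i ω} =
      meanCoverage θ (α / 2) (Real.pi * h ^ 2) lam := by
  have hsum := hN.tsum_measure_rel_and_lt_sir hα hh hθ (R := fun _ _ => True) .univ
  simp only [implies_true, true_and, restrictKernel_true] at hsum
  rw [hsum, lintegral_palmSum hN.poisson (isMonotoneKernel_sirKernel hθ.le (by positivity)
    (by positivity)), meanCoverage]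

theorem covProbStrongest_le (hN : IsRayleighNetwork P lam X g) (hα : 2 < α) (hh : 0 < h)
    (hθ : 0 < θ) (hlam : 0 < lam) :
    covProbStrongest α h X g P θ ≤ covFormulaStrongest α h θ lam := by
  rw [covFormulaStrongest_eq hα hh hθ hlam.le]
  exact ENNReal.toReal_mono
    (meanCoverage_ne_top hθ (by linarith) (by positivity) hlam)
    (measure_strongest_le.trans_eq (hN.tsum_measure_lt_sir (by linarith) hh hθ))

theorem covProbStrongest_eq (hN : IsRayleighNetwork P lam X g) (hα : 2 < α) (hh : 0 < h)
    (hθ : 1 ≤ θ) (hlam : 0 ≤ lam) :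
    covProbStrongest α h X g P θ = covFormulaStrongest α h θ lam := by
  have hθ0 : 0 < θ := one_pos.trans_le hθ
  rw [covFormulaStrongest_eq hα hh hθ0 hlam, ← hN.tsum_measure_lt_sir (by linarith) hh hθ0]
  exact congrArg ENNReal.toReal (measure_strongest_le.antisymm
    (tsum_measure_le_measure_strongest hN.poisson.measurable hN.fading_measurable hθ))

end IsRayleighNetwork

end CoverageFormula

theorem mainTheorem6 (α h θ : ℝ) (hα : 2 < α) (hh : 0 < h) (hθ : 0 < θ) :
    -- limits of the coverage expressions, for every threshold
    ((∀ lam : ℝ, 0 < lam → IntegrableOn (covIntegrandStrongest α h θ lam) (Ioi h)) ∧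
      Tendsto (fun lam => covFormulaClosest α h θ lam) (𝓝[>] 0) (𝓝 (covNlosClosest α θ)) ∧
      Tendsto (fun lam => covFormulaStrongest α h θ lam) (𝓝[>] 0) (𝓝 (covNlosStrongest α θ)) ∧
      Tendsto (fun lam => covFormulaClosest α h θ lam) atTop (𝓝 0) ∧
      Tendsto (fun lam => covFormulaStrongest α h θ lam) atTop (𝓝 0)) ∧
    -- limits of the probabilities of coverage in the Poisson network of density `lam`
    (∀ (Ω : ℝ → Type*) [∀ lam, MeasurableSpace (Ω lam)] (P : ∀ lam, Measure (Ω lam))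
      (X : ∀ lam, ℕ → Ω lam → Plane) (g : ∀ lam, ℕ → Ω lam → ℝ),
      (∀ lam : ℝ, 0 < lam → IsRayleighNetwork (P lam) lam (X lam) (g lam)) →
      Tendsto (fun lam => covProbClosest α h (X lam) (g lam) (P lam) θ) (𝓝[>] 0)
        (𝓝 (covNlosClosest α θ)) ∧
      (1 ≤ θ → Tendsto (fun lam => covProbStrongest α h (X lam) (g lam) (P lam) θ) (𝓝[>] 0)
        (𝓝 (covNlosStrongest α θ))) ∧
      Tendsto (fun lam => covProbClosest α h (X lam) (g lam) (P lam) θ) atTop (𝓝 0) ∧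
      Tendsto (fun lam => covProbStrongest α h (X lam) (g lam) (P lam) θ) atTop (𝓝 0)) := by
  refine ⟨⟨fun lam hlam => integrableOn_covIntegrandStrongest hα hh hθ hlam,
    tendsto_covFormulaClosest_zero α h θ, tendsto_covFormulaStrongest_zero hα hh hθ,
    tendsto_covFormulaClosest_atTop hα hh hθ, tendsto_covFormulaStrongest_atTop hα hh hθ⟩, ?_⟩
  intro Ω _ P X g hN
  have hclosest (lam : ℝ) (hlam : 0 < lam) :=
    ((hN lam hlam).covProbClosest_eq hα hh hθ hlam).symm
  refine ⟨?_, fun hθ1 => ?_, ?_, ?_⟩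
  · exact (tendsto_covFormulaClosest_zero α h θ).congr' (eventually_nhdsWithin_of_forall hclosest)
  · exact (tendsto_covFormulaStrongest_zero hα hh hθ).congr' (eventually_nhdsWithin_of_forall
      fun lam hlam => ((hN lam hlam).covProbStrongest_eq hα hh hθ1 (le_of_lt hlam)).symm)
  · exact (tendsto_covFormulaClosest_atTop hα hh hθ).congr' ((eventually_gt_atTop 0).mono hclosest)
  · exact squeeze_zero' (.of_forall fun _ => measureReal_nonneg)
      ((eventually_gt_atTop 0).mono fun lam hlam =>
        (hN lam hlam).covProbStrongest_le hα hh hθ hlam)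
      (tendsto_covFormulaStrongest_atTop hα hh hθ)
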